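/- For integers $N\ge 2$ let $1\le d_N\le N-1$ be integers such that $d_N N$ is even, and let $G_{N,d_N}$ be a graph chosen uniformly at random among all simple $d_N$-regular graphs on the labelled vertex set $[N]=\{1,\dots,N\}$. For a fixed finite simple graph $T$ whose vertices are named by positive integers, and a graph $G$ on $[N]$, write $T\subset G$ if every edge of $T$ is an edge of $G$ (with the names of the vertices kept). (1) Assume that $d_N\to\infty$, $N-d_N\to\infty$ and, for some constant $\eta>0$, $\big|\tfrac N2-d_N-\eta\sqrt{d_N}\big|\to\infty$ as $N\to\infty$. Then for every fixed finite simple graph $T$, with $n$ edges, $$\mathbb P\big(T\subset G_{N,d_N}\big)=\Big(\frac{d_N}{N}\Big)^{n}\Big(1+o\big(d_N^{-1/2}\big)\Big)\qquad (N\to\infty).$$ (2) If $d_N/N\to c$ with $c\in(0,1)\setminus\{\tfrac12\}$, then $G_{N,d_N}$ and the Erdős–Rényi graph $G(N,d_N/N)$ (each pair of vertices of $[N]$ is joined independently with probability $d_N/N$) converge in the sense of graphons to the same limit: for every fixed finite simple graph $T$, with $n$ edges, $\mathbb P(T\subset G_{N,d_N})$ and $\mathbb P(T\subset G(N,d_N/N))$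 both converge to $c^{n}$ as $N\to\infty$. -/

import Mathlib

open Filter Topology Asymptotics MeasureTheory

namespace RandomRegular

/-- The set of all `d`-regular simple graphs on the `N` labelled vertices `Fin N`. -/
def regularGraphs (N d : ℕ) : Set (SimpleGraph (Fin N)) :=
  open Classical in {G | G.IsRegularOfDegree d}

/-- The law of the uniform random `d`-regular graph on `N` labelled vertices. It is a probability
measure whenever there is a `d`-regular graph on `N` vertices. -/
noncomputable def uniformRegular (N d : ℕ) : Measure (SimpleGraph (Fin N)) :=
  ProbabilityTheory.uniformOn (regularGraphs N d)

/-- The law of the Erdős–Rényi graph `G(N, p)` on `N` labelled vertices: every pair of distinct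
vertices is joined with probability `p`, independently of the other pairs. (A real number
outside `[0, 1]` is replaced by the nearest point of `[0, 1]`.) -/
noncomputable def erdosRenyi (N : ℕ) (p : ℝ) : Measure (SimpleGraph (Fin N)) :=
  SimpleGraph.binomialRandom (Fin N) (Set.projIcc (0 : ℝ) 1 zero_le_one p)

/-- The event `T ⊂ G`, for a graph `T` whose vertices are named by natural numbers:
every edge of `T` is an edge of `G`, with the names of the vertices kept. -/
def containing (T : SimpleGraph ℕ) (N : ℕ) : Set (SimpleGraph (Fin N)) :=
  {G | ∀ i j : ℕ, T.Adj i j → ∃ (hi : i < N) (hj : j < N), G.Adj ⟨i, hi⟩ ⟨j, hj⟩}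

/-- The sequence of laws `μ N` of random graphs on `Fin N` converges in the sense of graphons,
with limit the functional `L`: for every fixed finite graph `T`, the probability that `T ⊂ G_N`
tends to `L T`. Isolated vertices of `T` play no role, so that finite graphs are represented by
graphs on `ℕ` with finitely many edges. -/
def HasGraphonLimit (μ : (N : ℕ) → Measure (SimpleGraph (Fin N)))
    (L : SimpleGraph ℕ → ℝ) : Prop :=
  ∀ T : SimpleGraph ℕ, T.edgeSet.Finite →
    Tendsto (fun N => (μ N).real (containing T N)) atTop (𝓝 (L T))

end RandomRegular

/-! The engine is switching. For vertices `a, b` of a bounded set `W` and `c, e` outside `W`,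
exchanging the edges `ab`, `ce` for `bc`, `ea` permutes the regular graphs that allow it, so it
gives exact identities between averages. Any test function `F` of the other pairs in `W` may be
included; the quartic terms cancel and a cubic identity remains (`avg_switch_cubic`). The second
tool is symmetry: a pendant edge leading to a vertex outside `W` can be averaged over all such
vertices, and regularity then fixes its contribution up to a small error (`avg_pendant`). With `p =
r / N`, it is enough to show that an edge is nearly independent, with probability about `p`, of a
pattern on the other pairs; a product over edges follows by induction.

Sparse case, `4 r ≤ N`. All terms of the cubic identity but one are evaluated by pendant edges. The
exception is again an edge probability, on two more vertices, and its error enters with a factor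
below `1/2`. Iterating this contraction about `r / 1000` times gives relative error `O(1/r)`
(`edgeBound_sparse`). If the complement is sparse, the same bound is applied to non-edges of the
complement.

Dense case, `p (1 - p) ≥ 1/8`. No contraction is available. In the centred variables `X = adj - p`
the identity says that `p (1 - p) E[X_ab F]` is minus the average of `F` times `X` along a path of
length 3 from `b` to `a`, up to `O(1/N)`. Taking for `F` another such path and summing gives two
nonnegative quantities, tr `X^4` and tr `X^6`, whose weighted sum is small; hence tr `X^4` has mean
`O(N^3)` (`avg_fourCycleSum_le`). Cauchy-Schwarz then bounds the path sum against functions of `a`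
and `b` separately, and an edge correlates with a pattern by only `O(N^(-3/4))` (`abs_avg_dev_le`).

Together the regimes give relative error `O(d^(-3/4)) = o(d^(-1/2))` once `d` and `N - d` tend to
infinity. When `d/N` tends to `c` in `(0, 1)` both do, and the graphon limit follows. -/

namespace RandomRegular

/-! ### Averages over regular graphs, relabelling and pendant edges -/

section Basic

variable {V : Type*}

open Classical in
/-- The adjacency indicator of a simple graph, as a real number. -/
noncomputable def adjInd (G : SimpleGraph V) (a b : V) : ℝ := if G.Adj a b then 1 else 0

lemma adjInd_of_adj {G : SimpleGraph V} {a b : V} (h : G.Adj a b) : adjInd G a b = 1 := by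
  simp [adjInd, h]

lemma adjInd_of_not_adj {G : SimpleGraph V} {a b : V} (h : ¬ G.Adj a b) : adjInd G a b = 0 := by
  simp [adjInd, h]

lemma adjInd_congr {V' : Type*} {G : SimpleGraph V} {G' : SimpleGraph V'} {a b : V} {a' b' : V'}
    (h : G.Adj a b ↔ G'.Adj a' b') : adjInd G a b = adjInd G' a' b' := by
  by_cases h' : G.Adj a b
  · rw [adjInd_of_adj h', adjInd_of_adj (h.1 h')]
  · rw [adjInd_of_not_adj h', adjInd_of_not_adj (mt h.2 h')]

lemma adjInd_comm (G : SimpleGraph V) (a b : V) : adjInd G a b = adjInd G b a := by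
  exact adjInd_congr (G.adj_comm a b)

lemma adjInd_self (G : SimpleGraph V) (a : V) : adjInd G a a = 0 := by
  simp [adjInd]

lemma adjInd_nonneg (G : SimpleGraph V) (a b : V) : 0 ≤ adjInd G a b := by
  unfold adjInd; split_ifs <;> norm_num

lemma adjInd_le_one (G : SimpleGraph V) (a b : V) : adjInd G a b ≤ 1 := by
  unfold adjInd; split_ifs <;> norm_num

/-- `F` depends only on which of the pairs in `S` are edges. -/
def DependsOnPairs (S : Set (Sym2 V)) (F : SimpleGraph V → ℝ) : Prop :=
  ∀ G G' : SimpleGraph V, (∀ e ∈ S, e ∈ G.edgeSet ↔ e ∈ G'.edgeSet) → F G = F G'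

/-- The unordered pairs of elements of `W`. -/
def pairsIn (W : Finset V) : Set (Sym2 V) := {e | ∀ v ∈ e, v ∈ W}

@[simp] lemma mk_mem_pairsIn {W : Finset V} {a b : V} : s(a, b) ∈ pairsIn W ↔ a ∈ W ∧ b ∈ W := by
  simp [pairsIn]


lemma DependsOnPairs.mono {S S' : Set (Sym2 V)} {F : SimpleGraph V → ℝ} (hF : DependsOnPairs S F)
    (h : S ⊆ S') : DependsOnPairs S' F :=
  fun G G' hG => hF G G' fun e he => hG e (h he)

lemma DependsOnPairs.mul {S : Set (Sym2 V)} {F F' : SimpleGraph V → ℝ} (hF : DependsOnPairs S F)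
    (hF' : DependsOnPairs S F') : DependsOnPairs S (fun G => F G * F' G) := by
  intro G G' hG
  simp only [hF G G' hG, hF' G G' hG]

lemma dependsOnPairs_adjInd {S : Set (Sym2 V)} {a b : V} (h : s(a, b) ∈ S) :
    DependsOnPairs S (fun G => adjInd G a b) := by
  intro G G' hG
  have := hG _ h
  simp only [SimpleGraph.mem_edgeSet] at this
  exact adjInd_congr this

lemma dependsOnPairs_adjInd_sub {S : Set (Sym2 V)} {a b : V} (h : s(a, b) ∈ S) (p : ℝ) :
    DependsOnPairs S (fun G => adjInd G a b - p) := by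
  intro G G' hG
  simp only [dependsOnPairs_adjInd h G G' hG]

lemma pairsIn_mono {W W' : Finset V} (h : W ⊆ W') : pairsIn W ⊆ pairsIn W' :=
  fun _ he v hv => h (he v hv)

/-- A function of the graph induced on `W` is unchanged by transposing two vertices outside `W`. -/
lemma DependsOnPairs.comap_swap [DecidableEq V] {W : Finset V} {F : SimpleGraph V → ℝ}
    (hF : DependsOnPairs (pairsIn W) F) {c c' : V} (hc : c ∉ W) (hc' : c' ∉ W)
    (G : SimpleGraph V) : F (G.comap (Equiv.swap c c')) = F G := by
  apply hF
  intro e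
  induction e with | _ u v => ?_
  intro he
  rw [mk_mem_pairsIn] at he
  have hu : Equiv.swap c c' u = u := Equiv.swap_apply_of_ne_of_ne
    (fun h => hc (h ▸ he.1)) (fun h => hc' (h ▸ he.1))
  have hv : Equiv.swap c c' v = v := Equiv.swap_apply_of_ne_of_ne
    (fun h => hc (h ▸ he.2)) (fun h => hc' (h ▸ he.2))
  simp [hu, hv]

/-- The 4-cycle `a b c e`, as a graph. -/
def squareGraph (a b c e : V) : SimpleGraph V :=
  SimpleGraph.fromEdgeSet {s(a, b), s(b, c), s(c, e), s(e, a)}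

/-- Exchange the edges and the non-edges of the 4-cycle `a b c e`. -/
def switchGraph (a b c e : V) (G : SimpleGraph V) : SimpleGraph V :=
  symmDiff G (squareGraph a b c e)

lemma switchGraph_switchGraph (a b c e : V) (G : SimpleGraph V) :
    switchGraph a b c e (switchGraph a b c e G) = G := by
  simp [switchGraph]

lemma switchGraph_adj {a b c e : V} {G : SimpleGraph V} {u v : V} (huv : u ≠ v) :
    (switchGraph a b c e G).Adj u v ↔
      ¬ (G.Adj u v ↔ s(u, v) ∈ ({s(a, b), s(b, c), s(c, e), s(e, a)} : Set (Sym2 V))) := by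
  simp only [switchGraph, symmDiff, squareGraph, SimpleGraph.sup_adj, SimpleGraph.sdiff_adj,
    SimpleGraph.fromEdgeSet_adj]
  tauto

/-- `G` can be switched along the 4-cycle `a b c e`, losing the edges `ab` and `ce`. -/
def Switchable (a b c e : V) (G : SimpleGraph V) : Prop :=
  G.Adj a b ∧ G.Adj c e ∧ ¬ G.Adj b c ∧ ¬ G.Adj e a

/-- The eight corrections are the two orientations of the gained pairs `bc`, `ea` and of the lost
pairs `ab`, `ce`. Each row contains equally many of both signs, which is why switching preserves
degrees. -/
lemma adjInd_switchGraph [DecidableEq V] {a b c e : V} (hab : a ≠ b) (hac : a ≠ c) (hae : a ≠ e)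
    (hbc : b ≠ c) (hbe : b ≠ e) (hce : c ≠ e) {G : SimpleGraph V} (hG : Switchable a b c e G)
    (u v : V) :
    adjInd (switchGraph a b c e G) u v = adjInd G u v
      + ((if u = b then if v = c then 1 else 0 else 0) + (if u = c then if v = b then 1 else 0 else 0)
      + (if u = e then if v = a then 1 else 0 else 0) + (if u = a then if v = e then 1 else 0 else 0)
      - (if u = a then if v = b then 1 else 0 else 0) - (if u = b then if v = a then 1 else 0 else 0)
      - (if u = c then if v = e then 1 else 0 else 0)
      - (if u = e then if v = c then 1 else 0 else 0)) := by
  obtain ⟨h1, h2, h3, h4⟩ := hG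
  rcases eq_or_ne u v with rfl | huv
  · simp only [adjInd_self]
    split_ifs <;> grind
  · have := switchGraph_adj (a := a) (b := b) (c := c) (e := e) (G := G) huv
    simp only [Set.mem_insert_iff, Set.mem_singleton_iff, Sym2.eq_iff] at this
    have h1' := h1.symm
    have h2' := h2.symm
    rw [G.adj_comm] at h3
    rw [G.adj_comm] at h4
    have h3' := h3
    have h4' := h4
    rw [G.adj_comm] at h3
    rw [G.adj_comm] at h4
    by_cases g : G.Adj u v <;> by_cases g' : (switchGraph a b c e G).Adj u v <;>
      simp only [adjInd_of_adj, adjInd_of_not_adj, g, g', not_false_eq_true, true_iff, false_iff] at this ⊢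
    all_goals
      by_cases ua : u = a
      · subst ua
        by_cases vb : v = b
        · subst vb; simp_all
        · by_cases ve : v = e
          · subst ve; simp_all
          · simp_all
      by_cases ub : u = b
      · subst ub
        by_cases va : v = a
        · subst va; simp_all
        · by_cases vc : v = c
          · subst vc; simp_all
          · simp_all
      by_cases uc : u = c
      · subst uc
        by_cases vb : v = b
        · subst vb; simp_all
        · by_cases ve : v = e
          · subst ve; simp_all
          · simp_all
      by_cases ue : u = e
      · subst ue
        by_cases va : v = a
        · subst va; simp_all
        · by_cases vc : v = c
          · subst vc; simp_all
          · simp_all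
      simp_all

variable [Fintype V]

/-- The finset of all `r`-regular graphs on a finite type, in terms of the row sums of the
adjacency matrix. -/
noncomputable def regSet (V : Type*) [Fintype V] (r : ℕ) : Finset (SimpleGraph V) :=
  (Set.toFinite {G : SimpleGraph V | ∀ a, ∑ b, adjInd G a b = r}).toFinset

lemma mem_regSet {r : ℕ} {G : SimpleGraph V} :
    G ∈ regSet V r ↔ ∀ a, ∑ b, adjInd G a b = r := by
  simp [regSet]

/-- The average of a function over all `r`-regular graphs. -/
noncomputable def avg (r : ℕ) (f : SimpleGraph V → ℝ) : ℝ :=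
  (∑ G ∈ regSet V r, f G) / (regSet V r).card

variable {r : ℕ}

lemma avg_congr {f g : SimpleGraph V → ℝ} (h : ∀ G ∈ regSet V r, f G = g G) :
    avg r f = avg r g := by
  unfold avg; rw [Finset.sum_congr rfl h]

lemma avg_mono {f g : SimpleGraph V → ℝ} (h : ∀ G ∈ regSet V r, f G ≤ g G) :
    avg r f ≤ avg r g := by
  unfold avg
  exact div_le_div_of_nonneg_right (Finset.sum_le_sum h) (by positivity)

lemma avg_nonneg {f : SimpleGraph V → ℝ} (h : ∀ G ∈ regSet V r, 0 ≤ f G) : 0 ≤ avg r f := by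
  unfold avg
  exact div_nonneg (Finset.sum_nonneg h) (by positivity)

lemma avg_add (f g : SimpleGraph V → ℝ) :
    avg r (fun G => f G + g G) = avg r f + avg r g := by
  unfold avg; rw [Finset.sum_add_distrib, add_div]

lemma avg_sub (f g : SimpleGraph V → ℝ) :
    avg r (fun G => f G - g G) = avg r f - avg r g := by
  unfold avg; rw [Finset.sum_sub_distrib, sub_div]

lemma avg_neg (f : SimpleGraph V → ℝ) : avg r (fun G => - f G) = - avg r f := by
  unfold avg; rw [Finset.sum_neg_distrib, neg_div]

lemma avg_const_mul (c : ℝ) (f : SimpleGraph V → ℝ) :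
    avg r (fun G => c * f G) = c * avg r f := by
  unfold avg; rw [← Finset.mul_sum, mul_div_assoc]

lemma avg_sum {ι : Type*} (s : Finset ι) (f : ι → SimpleGraph V → ℝ) :
    avg r (fun G => ∑ i ∈ s, f i G) = ∑ i ∈ s, avg r (f i) := by
  unfold avg; rw [Finset.sum_comm, Finset.sum_div]

/-- Only an inequality, and only for `c ≥ 0`: if there is no `r`-regular graph, division by zero
makes every average `0`. -/
lemma avg_const_le {c : ℝ} (hc : 0 ≤ c) : avg r (fun _ : SimpleGraph V => c) ≤ c := by
  unfold avg
  rw [Finset.sum_const, nsmul_eq_mul]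
  exact div_le_of_le_mul₀ (by positivity) hc (by rw [mul_comm])

lemma avg_const (h : (regSet V r).Nonempty) (c : ℝ) :
    avg r (fun _ : SimpleGraph V => c) = c := by
  unfold avg
  rw [Finset.sum_const, nsmul_eq_mul, mul_div_cancel_left₀]
  exact_mod_cast h.card_pos.ne'

lemma abs_avg_le_avg_abs (f : SimpleGraph V → ℝ) : |avg r f| ≤ avg r (fun G => |f G|) := by
  rw [abs_le, ← avg_neg]
  exact ⟨avg_mono fun G _ => neg_abs_le _, avg_mono fun G _ => le_abs_self _⟩

lemma abs_avg_le {f : SimpleGraph V → ℝ} {c : ℝ} (hc : 0 ≤ c)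
    (h : ∀ G ∈ regSet V r, |f G| ≤ c) : |avg r f| ≤ c :=
  (abs_avg_le_avg_abs f).trans ((avg_mono h).trans (avg_const_le hc))

/-- Averages over regular graphs are invariant under relabelling. -/
lemma avg_comap (σ : Equiv.Perm V) (f : SimpleGraph V → ℝ) :
    avg r (fun G => f (G.comap σ)) = avg r f := by
  have key : ∀ (τ : Equiv.Perm V), ∀ G ∈ regSet V r, G.comap τ ∈ regSet V r := by
    intro τ G hG
    rw [mem_regSet] at hG ⊢
    intro a
    rw [← hG (τ a), ← Equiv.sum_comp τ (fun b => adjInd G (τ a) b)]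
    rfl
  unfold avg
  congr 1
  refine Finset.sum_nbij' (fun G => G.comap σ) (fun G => G.comap σ.symm) (key σ) (key σ.symm)
    ?_ ?_ (fun _ _ => rfl) <;>
  · intro G _
    ext a b
    simp


/-- Summing over the position of a pendant vertex. -/
lemma avg_pendant [DecidableEq V] {W : Finset V} {F : SimpleGraph V → ℝ}
    (hF : DependsOnPairs (pairsIn W) F) {b c : V} (hb : b ∈ W) (hc : c ∉ W) :
    ((Fintype.card V : ℝ) - W.card) * avg r (fun G => adjInd G b c * F G) =
      avg r (fun G => (r - ∑ v ∈ W, adjInd G b v) * F G) := by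
  -- Transposing `c` and `c'` fixes `b` and leaves `F` unchanged, so all positions of the pendant
  -- vertex have the same average.
  have h1 : ∀ c' ∈ Wᶜ, avg r (fun G => adjInd G b c' * F G) =
      avg r (fun G => adjInd G b c * F G) := by
    intro c' hc'
    rw [Finset.mem_compl] at hc'
    rw [← avg_comap (Equiv.swap c c') (fun G => adjInd G b c' * F G)]
    refine avg_congr fun G _ => ?_
    rw [hF.comap_swap hc hc']
    have : Equiv.swap c c' b = b := Equiv.swap_apply_of_ne_of_ne
      (fun h => hc (h ▸ hb)) (fun h => hc' (h ▸ hb))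
    rw [adjInd_congr (G' := G) (a' := b) (b' := c)]
    simp [this]
  have h2 : avg r (fun G => (r - ∑ v ∈ W, adjInd G b v) * F G) =
      avg r (fun G => ∑ c' ∈ Wᶜ, adjInd G b c' * F G) := by
    refine avg_congr fun G hG => ?_
    rw [mem_regSet] at hG
    rw [← hG b, ← Finset.sum_mul, ← Finset.sum_add_sum_compl W]
    ring
  rw [h2, avg_sum, Finset.sum_congr rfl h1, Finset.sum_const, nsmul_eq_mul, Finset.card_compl,
    Nat.cast_sub (Finset.card_le_univ W)]

lemma switchGraph_mem_regSet {a b c e : V} (hab : a ≠ b) (hac : a ≠ c) (hae : a ≠ e)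
    (hbc : b ≠ c) (hbe : b ≠ e) (hce : c ≠ e) {G : SimpleGraph V} (hG : Switchable a b c e G)
    (hr : G ∈ regSet V r) : switchGraph a b c e G ∈ regSet V r := by
  classical
  rw [mem_regSet] at hr ⊢
  intro u
  simp only [adjInd_switchGraph hab hac hae hbc hbe hce hG, Finset.sum_add_distrib,
    Finset.sum_sub_distrib, hr u]
  by_cases ua : u = a <;> by_cases ub : u = b <;> by_cases uc : u = c <;> by_cases ue : u = e <;>
    simp [ua, ub, uc, ue] <;> grind

end Basic

/-! ### The switching identity -/

section Switching

variable {V : Type*}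

lemma squareGraph_rotate (a b c e : V) : squareGraph b c e a = squareGraph a b c e := by
  unfold squareGraph
  congr 1
  ext x
  simp only [Set.mem_insert_iff, Set.mem_singleton_iff]
  tauto

lemma switchGraph_rotate (a b c e : V) (G : SimpleGraph V) :
    switchGraph b c e a G = switchGraph a b c e G := by
  rw [switchGraph, switchGraph, squareGraph_rotate]

lemma Switchable.switchGraph {a b c e : V} (hab : a ≠ b) (hae : a ≠ e)
    (hbc : b ≠ c) (hce : c ≠ e) {G : SimpleGraph V} (hG : Switchable a b c e G) :
    Switchable b c e a (switchGraph a b c e G) := by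
  obtain ⟨h1, h2, h3, h4⟩ := hG
  refine ⟨?_, ?_, ?_, ?_⟩
  · rw [switchGraph_adj hbc]; simp [h3]
  · rw [switchGraph_adj hae.symm]; simp [h4]
  · rw [switchGraph_adj hce]; simp [h2]
  · rw [switchGraph_adj hab]; simp [h1]

/-- Of the four switched pairs only `ab` can lie inside `W`, and `F` does not look at it. -/
lemma DependsOnPairs.switchGraph {W : Finset V} {a b c e : V} {F : SimpleGraph V → ℝ}
    (hF : DependsOnPairs (pairsIn W \ {s(a, b)}) F) (hc : c ∉ W) (he : e ∉ W)
    (G : SimpleGraph V) : F (switchGraph a b c e G) = F G := by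
  apply hF
  intro x
  induction x with | _ u v => ?_
  rintro ⟨huv, hab⟩
  rw [mk_mem_pairsIn] at huv
  rcases eq_or_ne u v with rfl | hne
  · simp
  · rw [SimpleGraph.mem_edgeSet, SimpleGraph.mem_edgeSet, switchGraph_adj hne]
    have huc : u ≠ c := fun h => hc (h ▸ huv.1)
    have hue : u ≠ e := fun h => he (h ▸ huv.1)
    have hvc : v ≠ c := fun h => hc (h ▸ huv.2)
    have hve : v ≠ e := fun h => he (h ▸ huv.2)
    have : s(u, v) ∉ ({s(a, b), s(b, c), s(c, e), s(e, a)} : Set (Sym2 V)) := by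
      simp only [Set.mem_singleton_iff] at hab
      simp only [Set.mem_insert_iff, hab, Set.mem_singleton_iff, Sym2.eq_iff]
      tauto
    simp [this]

open Classical in
lemma switchable_indicator (a b c e : V) (G : SimpleGraph V) :
    adjInd G a b * adjInd G c e * (1 - adjInd G b c) * (1 - adjInd G e a) =
      if Switchable a b c e G then 1 else 0 := by
  unfold Switchable
  by_cases h1 : G.Adj a b <;> by_cases h2 : G.Adj c e <;> by_cases h3 : G.Adj b c <;>
    by_cases h4 : G.Adj e a <;> simp [h1, h2, h3, h4, adjInd_of_adj, adjInd_of_not_adj]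

variable [Fintype V] {r : ℕ}

/-- The switching identity: switching along a 4-cycle preserves the uniform measure on regular
graphs. -/
lemma avg_switch {W : Finset V} {a b c e : V} {F : SimpleGraph V → ℝ}
    (hF : DependsOnPairs (pairsIn W \ {s(a, b)}) F) (ha : a ∈ W) (hb : b ∈ W) (hab : a ≠ b)
    (hc : c ∉ W) (he : e ∉ W) (hce : c ≠ e) :
    avg r (fun G =>
      adjInd G a b * adjInd G c e * (1 - adjInd G b c) * (1 - adjInd G e a) * F G) =
    avg r (fun G =>
      adjInd G b c * adjInd G e a * (1 - adjInd G c e) * (1 - adjInd G a b) * F G) := by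
  classical
  have hac : a ≠ c := fun h => hc (h ▸ ha)
  have hae : a ≠ e := fun h => he (h ▸ ha)
  have hbc : b ≠ c := fun h => hc (h ▸ hb)
  have hbe : b ≠ e := fun h => he (h ▸ hb)
  simp only [switchable_indicator, ite_mul, one_mul, zero_mul]
  unfold avg
  congr 1
  rw [← Finset.sum_filter, ← Finset.sum_filter]
  -- Switching is an involution, so it is its own inverse between the graphs switchable in one
  -- direction and those switchable in the other.
  refine Finset.sum_nbij' (switchGraph a b c e) (switchGraph a b c e) ?_ ?_
    (fun G _ => switchGraph_switchGraph a b c e G) (fun G _ => switchGraph_switchGraph a b c e G)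
    (fun G _ => (hF.switchGraph hc he G).symm)
  · intro G hG
    rw [Finset.mem_filter] at hG ⊢
    exact ⟨switchGraph_mem_regSet hab hac hae hbc hbe hce hG.2 hG.1,
      hG.2.switchGraph hab hae hbc hce⟩
  · intro G hG
    rw [Finset.mem_filter] at hG ⊢
    rw [← switchGraph_rotate]
    refine ⟨switchGraph_mem_regSet hbc hbe hab.symm hce hac.symm hae.symm hG.2 hG.1, ?_⟩
    have := hG.2.switchGraph hbc hab.symm hce hae.symm
    rw [switchGraph_rotate] at this ⊢
    exact ⟨this.2.1, this.1, this.2.2.2, this.2.2.1⟩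

/-- The cubic form of the switching identity. -/
lemma avg_switch_cubic {W : Finset V} {a b c e : V} {F : SimpleGraph V → ℝ}
    (hF : DependsOnPairs (pairsIn W \ {s(a, b)}) F) (ha : a ∈ W) (hb : b ∈ W) (hab : a ≠ b)
    (hc : c ∉ W) (he : e ∉ W) (hce : c ≠ e) :
    avg r (fun G => (adjInd G a b * adjInd G c e - adjInd G b c * adjInd G e a
      - adjInd G a b * adjInd G c e * adjInd G b c - adjInd G a b * adjInd G c e * adjInd G e a
      + adjInd G a b * adjInd G b c * adjInd G e a
      + adjInd G c e * adjInd G b c * adjInd G e a) * F G) = 0 := by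
  have h := avg_switch (r := r) hF ha hb hab hc he hce
  rw [← sub_eq_zero, ← avg_sub] at h
  rw [← h]
  refine avg_congr fun G _ => ?_
  ring

end Switching

/-! ### Sparse regime: contraction for edge probabilities -/

section Sparse


lemma sum_adjInd_le_card {V : Type*} (G : SimpleGraph V) (W : Finset V) (b : V) :
    ∑ v ∈ W, adjInd G b v ≤ W.card := by
  have := Finset.sum_le_card_nsmul W (fun v => adjInd G b v) 1 (fun v _ => adjInd_le_one G b v)
  simpa using this

variable {V : Type*} [Fintype V] [DecidableEq V] {r : ℕ}

/-- The effect of a pendant edge on the average of a nonnegative function. -/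
lemma avg_pendant_bounds {W : Finset V} {F : SimpleGraph V → ℝ}
    (hF : DependsOnPairs (pairsIn W) F) (hF0 : ∀ G, 0 ≤ F G) {b c : V} (hb : b ∈ W) (hc : c ∉ W)
    (hW : 2 * (W.card : ℝ) ≤ Fintype.card V) (hr : r ≤ Fintype.card V) :
    |avg r (fun G => adjInd G b c * F G) - r / Fintype.card V * avg r F|
      ≤ 2 * W.card / Fintype.card V * avg r F := by
  have h := avg_pendant (r := r) hF hb hc
  have hr' : (r : ℝ) ≤ (Fintype.card V : ℝ) := Nat.cast_le.2 hr
  have hw1 : (1 : ℝ) ≤ W.card := by exact_mod_cast Finset.card_pos.2 ⟨b, hb⟩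
  have hE : 0 ≤ avg r F := avg_nonneg fun G _ => hF0 G
  have hlow : (r - (W.card : ℝ)) * avg r F
      ≤ avg r (fun G => (r - ∑ v ∈ W, adjInd G b v) * F G) := by
    rw [← avg_const_mul]
    refine avg_mono fun G _ => mul_le_mul_of_nonneg_right ?_ (hF0 G)
    have := sum_adjInd_le_card G W b
    linarith
  have hup : avg r (fun G => (r - ∑ v ∈ W, adjInd G b v) * F G) ≤ r * avg r F := by
    rw [← avg_const_mul]
    refine avg_mono fun G _ => mul_le_mul_of_nonneg_right ?_ (hF0 G)
    have : 0 ≤ ∑ v ∈ W, adjInd G b v := Finset.sum_nonneg fun v _ => adjInd_nonneg G b v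
    linarith
  rw [← h] at hlow hup
  have hr0 : (0 : ℝ) ≤ r := Nat.cast_nonneg r
  generalize avg r F = E at *
  generalize avg r (fun G => adjInd G b c * F G) = E1 at *
  generalize (Fintype.card V : ℝ) = N at *
  generalize (W.card : ℝ) = w at *
  generalize (r : ℝ) = r at *
  have hN : 0 < N := by linarith
  have hNw : 0 < N - w := by linarith
  have e1 : r / N * E = (r * E) / N := by ring
  have e2 : 2 * w / N * E = (2 * w * E) / N := by ring
  rw [e1, e2, abs_le, neg_le_sub_iff_le_add, sub_le_iff_le_add, ← add_div, ← sub_le_iff_le_add,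
    ← sub_div, div_le_iff₀ hN, le_div_iff₀ hN]
  constructor
  · refine le_of_mul_le_mul_right ?_ hNw
    nlinarith [mul_nonneg (mul_nonneg (by linarith : (0 : ℝ) ≤ w) hE)
      (by linarith : (0 : ℝ) ≤ N + r - 2 * w), mul_le_mul_of_nonneg_right hlow hN.le]
  · refine le_of_mul_le_mul_right ?_ hNw
    nlinarith [mul_nonneg (mul_nonneg (by linarith : (0 : ℝ) ≤ w) hE)
      (by linarith : (0 : ℝ) ≤ 2 * (N - w) - r), mul_le_mul_of_nonneg_right hup hN.le]

/-- Two pendant edges in succession: `(1 + η)^2 - 1 ≤ 3 η` for `η ≤ 1`. -/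
lemma abs_sub_sq_mul_le {p η x y z : ℝ} (hp : 0 ≤ p) (hη : 0 ≤ η) (hη1 : η ≤ 1) (hz : 0 ≤ z)
    (hxy : |x - p * y| ≤ η * (p * y)) (hyz : |y - p * z| ≤ η * (p * z)) :
    |x - p ^ 2 * z| ≤ 3 * η * (p ^ 2 * z) := by
  rw [abs_le] at *
  obtain ⟨h1, h2⟩ := hxy
  obtain ⟨h3, h4⟩ := hyz
  have hp2 : 0 ≤ p ^ 2 * z := by positivity
  have h3' := mul_le_mul_of_nonneg_left h3 hp
  have h4' := mul_le_mul_of_nonneg_left h4 hp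
  have h5 := mul_le_mul_of_nonneg_left h4' hη
  have h6 := mul_le_mul_of_nonneg_right hη1 (mul_nonneg hη hp2)
  constructor <;> nlinarith

/-- The averages `t₁, …, t₆` of the terms of the cubic switching identity determine the ratio of
`R` and `Z` up to a constant factor. -/
lemma le_of_switching_terms {p η Z R t1 t2 t3 t4 t5 t6 : ℝ} (hp : 0 < p) (hp4 : p ≤ 1 / 4)
    (hη : 0 ≤ η) (hη1 : η ≤ 1 / 100) (hZ : 0 ≤ Z) (hR : 0 ≤ R)
    (h1 : |t1 - p * R| ≤ η * (p * R)) (h2 : |t2 - p ^ 2 * Z| ≤ 3 * η * (p ^ 2 * Z))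
    (h3 : |t3 - p ^ 2 * R| ≤ 3 * η * (p ^ 2 * R)) (h4 : |t4 - p ^ 2 * R| ≤ 3 * η * (p ^ 2 * R))
    (h5 : |t5 - p ^ 2 * R| ≤ 3 * η * (p ^ 2 * R)) (h6 : 0 ≤ t6)
    (h : t1 - t2 - t3 - t4 + t5 + t6 = 0) : R ≤ 2 * (p * Z) := by
  rw [abs_le] at *
  -- The term `t6` is dropped by its sign. The three terms of size `p^2 R` leave a net coefficient
  -- 1, with total error `9 η`.
  have key : p * R ≤ p * (η * R + (1 + 3 * η) * (p * Z) + (1 + 9 * η) * (p * R)) := by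
    linarith [h1.1, h2.2, h3.2, h4.2, h5.1]
  have key := le_of_mul_le_mul_left key hp
  have a1 : η * R ≤ 1 / 100 * R := mul_le_mul_of_nonneg_right hη1 hR
  have a2 : (1 + 3 * η) * (p * Z) ≤ (1 + 3 / 100) * (p * Z) :=
    mul_le_mul_of_nonneg_right (by linarith) (by positivity)
  have a3 : (1 + 9 * η) * (p * R) ≤ (1 + 9 / 100) * (1 / 4 * R) :=
    mul_le_mul (by linarith) (mul_le_mul_of_nonneg_right hp4 hR) (by positivity) (by norm_num)
  have : 0 ≤ p * Z := by positivity
  linarith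

/-- The contraction step: an error `ε` for the edge closing a longer path yields an error
`12 η + ε / 2`. -/
lemma abs_sub_le_of_switching_terms {p η ε Z R t1 t2 t3 t4 t5 t6 : ℝ} (hp : 0 < p)
    (hp4 : p ≤ 1 / 4) (hη : 0 ≤ η) (hη1 : η ≤ 1 / 100) (hε : 0 ≤ ε) (hZ : 0 ≤ Z) (hR : 0 ≤ R)
    (h1 : |t1 - p * R| ≤ η * (p * R)) (h2 : |t2 - p ^ 2 * Z| ≤ 3 * η * (p ^ 2 * Z))
    (h3 : |t3 - p ^ 2 * R| ≤ 3 * η * (p ^ 2 * R)) (h4 : |t4 - p ^ 2 * R| ≤ 3 * η * (p ^ 2 * R))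
    (h5 : |t5 - p ^ 2 * R| ≤ 3 * η * (p ^ 2 * R)) (h6 : |t6 - p * t2| ≤ ε * (p * t2))
    (h : t1 - t2 - t3 - t4 + t5 + t6 = 0) :
    |R - p * Z| ≤ (12 * η + ε / 2) * (p * Z) := by
  have hS : 0 ≤ p * Z := by positivity
  -- With every term replaced by its main value, the identity reads `p R - p^2 Z - p^2 R + p^3 Z = p
  -- (1 - p) (R - p Z) = 0`. The right-hand side collects the errors, divided by `p`.
  have hb : |(1 - p) * (R - p * Z)| ≤
      η * R + 3 * η * (p * Z) + 9 * η * (p * R) + 3 * η * (p * (p * Z))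
        + ε * (1 + 3 * η) * (p * (p * Z)) := by
    refine le_of_mul_le_mul_left ?_ hp
    rw [← abs_of_pos hp, ← abs_mul, abs_of_pos hp]
    have h2' : |p * t2 - p * (p ^ 2 * Z)| ≤ p * (3 * η * (p ^ 2 * Z)) := by
      rw [← mul_sub, abs_mul, abs_of_pos hp]
      exact mul_le_mul_of_nonneg_left h2 hp.le
    have h7 : ε * (p * t2) ≤ ε * (p * ((1 + 3 * η) * (p ^ 2 * Z))) := by
      refine mul_le_mul_of_nonneg_left (mul_le_mul_of_nonneg_left ?_ hp.le) hε
      linarith [(abs_le.1 h2).2]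
    rw [abs_le] at *
    constructor <;> nlinarith [h1.1, h1.2, h2.1, h2.2, h3.1, h3.2, h4.1, h4.2, h5.1, h5.2, h6.1,
      h6.2, h2'.1, h2'.2]
  rw [abs_mul, abs_of_pos (by linarith)] at hb
  have hRD : R ≤ p * Z + |R - p * Z| := by linarith [le_abs_self (R - p * Z)]
  have hD : 0 ≤ |R - p * Z| := abs_nonneg _
  generalize |R - p * Z| = D at *
  generalize p * Z = S at *
  have b1 : p * R ≤ 1 / 4 * R := mul_le_mul_of_nonneg_right hp4 hR
  have b2 : p * S ≤ 1 / 4 * S := mul_le_mul_of_nonneg_right hp4 hS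
  have b3 : η * (p * R) ≤ η * (1 / 4 * R) := mul_le_mul_of_nonneg_left b1 hη
  have b4 : η * (p * S) ≤ η * (1 / 4 * S) := mul_le_mul_of_nonneg_left b2 hη
  have b5 : ε * (1 + 3 * η) * (p * S) ≤ ε * (1 + 3 / 100) * (1 / 4 * S) :=
    mul_le_mul (mul_le_mul_of_nonneg_left (by linarith) hε) b2 (by positivity) (by positivity)
  have b6 : η * R ≤ η * S + η * D := by
    rw [← mul_add]; exact mul_le_mul_of_nonneg_left hRD hη
  have b7 : η * D ≤ 1 / 100 * D := mul_le_mul_of_nonneg_right hη1 hD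
  have b8 : 3 / 4 * D ≤ (1 - p) * D := mul_le_mul_of_nonneg_right (by linarith) hD
  have b9 : 0 ≤ η * S := by positivity
  have b10 : 0 ≤ ε * S := by positivity
  nlinarith

/-- Edge probabilities, conditionally on any event determined by at most `m` vertices, are equal to
`r / N` up to a relative error `ε`. -/
def EdgeBound (V : Type*) [Fintype V] (r m : ℕ) (ε : ℝ) : Prop :=
  ∀ (W : Finset V) (a b : V) (F : SimpleGraph V → ℝ), W.card ≤ m → a ∈ W → b ∈ W → a ≠ b →
    DependsOnPairs (pairsIn W \ {s(a, b)}) F → (∀ G, 0 ≤ F G) →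
    |avg r (fun G => adjInd G a b * F G) - r / Fintype.card V * avg r F|
      ≤ ε * (r / Fintype.card V * avg r F)

/-- A priori bound and contraction for edge probabilities. -/
lemma edgeBound_step {m : ℕ} (hr : 400 * (m + 2) ≤ r) (hN : 4 * r ≤ Fintype.card V) :
    EdgeBound V r m 1 ∧ ∀ ε : ℝ, 0 ≤ ε → EdgeBound V r (m + 2) ε →
      EdgeBound V r m (12 * (2 * (m + 2) / r) + ε / 2) := by
  have hr0 : 0 < r := by omega
  have hr0' : (0 : ℝ) < r := Nat.cast_pos.2 hr0
  have hN' : 4 * (r : ℝ) ≤ Fintype.card V := by exact_mod_cast hN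
  have hr' : 400 * ((m : ℝ) + 2) ≤ r := by exact_mod_cast hr
  have hN0 : (0 : ℝ) < Fintype.card V := by linarith
  set p : ℝ := r / Fintype.card V with hp
  set η : ℝ := 2 * (m + 2) / r with hη
  have hp0 : 0 < p := by positivity
  have hp4 : p ≤ 1 / 4 := by rw [hp, div_le_iff₀ hN0]; linarith
  have hη0 : 0 ≤ η := by positivity
  have hη1 : η ≤ 1 / 100 := by rw [hη, div_le_iff₀ hr0']; linarith
  -- The pendant error `2 |W| / N`, measured relative to `p = r / N`, is `2 |W| / r`, hence at most
  -- `η`.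
  have pend : ∀ {W : Finset V} {F : SimpleGraph V → ℝ}, DependsOnPairs (pairsIn W) F →
      (∀ G, 0 ≤ F G) → ∀ {b c : V}, b ∈ W → c ∉ W → W.card ≤ m + 2 →
      |avg r (fun G => adjInd G b c * F G) - p * avg r F| ≤ η * (p * avg r F) := by
    intro W F hF hF0 b c hb hc hW
    have hW' : (W.card : ℝ) ≤ m + 2 := by exact_mod_cast hW
    refine (avg_pendant_bounds hF hF0 hb hc (by linarith) (by omega)).trans ?_
    rw [← mul_assoc]
    refine mul_le_mul_of_nonneg_right ?_ (avg_nonneg fun G _ => hF0 G)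
    rw [hη, hp, div_mul_div_cancel₀ hr0'.ne']
    gcongr
  have main : ∀ (W : Finset V) (a b : V) (F : SimpleGraph V → ℝ), W.card ≤ m → a ∈ W → b ∈ W →
      a ≠ b → DependsOnPairs (pairsIn W \ {s(a, b)}) F → (∀ G, 0 ≤ F G) →
      avg r (fun G => adjInd G a b * F G) ≤ 2 * (p * avg r F) ∧
      ∀ ε : ℝ, 0 ≤ ε → EdgeBound V r (m + 2) ε →
        |avg r (fun G => adjInd G a b * F G) - p * avg r F| ≤ (12 * η + ε / 2) * (p * avg r F) := by
    intro W a b F hW ha hb hab hF hF0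
    have hcard : W.card + 2 ≤ Fintype.card V := by omega
    obtain ⟨c, hc⟩ : ∃ c, c ∉ W := by
      by_contra! h
      have := Finset.card_le_card (show Finset.univ ⊆ W from fun x _ => h x)
      rw [Finset.card_univ] at this; omega
    obtain ⟨e, he'⟩ : ∃ e, e ∉ insert c W := by
      by_contra! h
      have := Finset.card_le_card (show Finset.univ ⊆ insert c W from fun x _ => h x)
      rw [Finset.card_univ, Finset.card_insert_of_notMem hc] at this; omega
    have he : e ∉ W := fun h => he' (Finset.mem_insert_of_mem h)
    have hce : c ≠ e := fun h => he' (h ▸ Finset.mem_insert_self c W)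
    have hWe : (insert e W).card ≤ m + 2 := by rw [Finset.card_insert_of_notMem he]; omega
    have hWce : (insert c (insert e W)).card ≤ m + 2 := by
      have := Finset.card_insert_le c (insert e W)
      rw [Finset.card_insert_of_notMem he] at this; omega
    have hcWe : c ∉ insert e W := by simp [hce, hc]
    have hWeW : pairsIn W ⊆ pairsIn (insert e W) := pairsIn_mono (Finset.subset_insert e W)
    have hFW : DependsOnPairs (pairsIn W) F := hF.mono Set.sdiff_subset
    have hxF : DependsOnPairs (pairsIn W) (fun G => adjInd G a b * F G) :=
      (dependsOnPairs_adjInd (by simp [ha, hb])).mul hFW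
    have hxF0 : ∀ G, 0 ≤ adjInd G a b * F G := fun G => mul_nonneg (adjInd_nonneg G a b) (hF0 G)
    have two : ∀ {F' : SimpleGraph V → ℝ}, DependsOnPairs (pairsIn W) F' → (∀ G, 0 ≤ F' G) →
        ∀ {c e : V}, c ∉ W → e ∉ W → c ≠ e → ∀ {u v : V}, u ∈ insert e W → v ∈ W →
        |avg r (fun G => adjInd G u c * (adjInd G v e * F' G)) - p ^ 2 * avg r F'|
          ≤ 3 * η * (p ^ 2 * avg r F') := by
      intro F' hF' hF'0 c e hc he hce u v hu hv
      refine abs_sub_sq_mul_le hp0.le hη0 (by linarith) (avg_nonneg fun G _ => hF'0 G)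
        (pend ?_ (fun G => mul_nonneg (adjInd_nonneg G v e) (hF'0 G)) hu (by simp [hce, hc])
          (by rw [Finset.card_insert_of_notMem he]; omega))
        (pend hF' hF'0 hv he (by omega))
      exact (dependsOnPairs_adjInd (by simp [hv])).mul
        (hF'.mono (pairsIn_mono (Finset.subset_insert e W)))
    have h1 : |avg r (fun G => adjInd G e c * (adjInd G a b * F G))
        - p * avg r (fun G => adjInd G a b * F G)| ≤ η * (p * avg r (fun G => adjInd G a b * F G)) :=
      pend (hxF.mono hWeW) hxF0 (Finset.mem_insert_self e W) hcWe hWe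
    have h2 := two hFW hF0 hc he hce (Finset.mem_insert_of_mem hb) ha
    have h3 := two hxF hxF0 hc he hce (Finset.mem_insert_self e W) ha
    have h4 := two hxF hxF0 he hc hce.symm (Finset.mem_insert_self c W) hb
    have h5 := two hxF hxF0 hc he hce (Finset.mem_insert_of_mem hb) ha
    have h6 : 0 ≤ avg r (fun G => adjInd G c e * (adjInd G b c * (adjInd G a e * F G))) :=
      avg_nonneg fun G _ => mul_nonneg (adjInd_nonneg _ _ _) (mul_nonneg (adjInd_nonneg _ _ _)
        (mul_nonneg (adjInd_nonneg _ _ _) (hF0 G)))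
    have hsw := avg_switch_cubic (r := r) hF ha hb hab hc he hce
    have hsum : avg r (fun G => adjInd G e c * (adjInd G a b * F G))
        - avg r (fun G => adjInd G b c * (adjInd G a e * F G))
        - avg r (fun G => adjInd G e c * (adjInd G a e * (adjInd G a b * F G)))
        - avg r (fun G => adjInd G c e * (adjInd G b c * (adjInd G a b * F G)))
        + avg r (fun G => adjInd G b c * (adjInd G a e * (adjInd G a b * F G)))
        + avg r (fun G => adjInd G c e * (adjInd G b c * (adjInd G a e * F G))) = 0 := by
      rw [← hsw, ← avg_sub, ← avg_sub, ← avg_sub, ← avg_add, ← avg_add]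
      refine avg_congr fun G _ => ?_
      rw [adjInd_comm G e c, adjInd_comm G e a]
      ring
    have hZ : 0 ≤ avg r F := avg_nonneg fun G _ => hF0 G
    have hR : 0 ≤ avg r (fun G => adjInd G a b * F G) := avg_nonneg fun G _ => hxF0 G
    refine ⟨le_of_switching_terms hp0 hp4 hη0 hη1 hZ hR h1 h2 h3 h4 h5 h6 hsum, ?_⟩
    intro ε hε hbound
    refine abs_sub_le_of_switching_terms hp0 hp4 hη0 hη1 hε hZ hR h1 h2 h3 h4 h5 ?_ hsum
    -- The sixth term is the second one with the edge `ce` added. The hypothesis is applied on `W ∪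
    -- {c, e}` to this pair, with test function the indicators of `bc` and `ae` times `F`, which
    -- ignores `ce`.
    refine hbound (insert c (insert e W)) c e _ hWce (by simp) (by simp) hce ?_
      (fun G => mul_nonneg (adjInd_nonneg _ _ _) (mul_nonneg (adjInd_nonneg _ _ _) (hF0 G)))
    have hbc : b ≠ c := fun h => hc (h ▸ hb)
    have hbe : b ≠ e := fun h => he (h ▸ hb)
    have hac : a ≠ c := fun h => hc (h ▸ ha)
    have hae : a ≠ e := fun h => he (h ▸ ha)
    refine (dependsOnPairs_adjInd ?_).mul ((dependsOnPairs_adjInd ?_).mul (hFW.mono ?_))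
    · simp [hb, hbc, hbe]
    · simp [ha, hac, hae]
    · intro x hx
      refine ⟨pairsIn_mono (by intro y; simp; tauto) hx, ?_⟩
      rintro rfl
      exact hc (mk_mem_pairsIn.1 hx).1
  constructor
  · intro W a b F hW ha hb hab hF hF0
    have h := (main W a b F hW ha hb hab hF hF0).1
    have hR : 0 ≤ avg r (fun G => adjInd G a b * F G) :=
      avg_nonneg fun G _ => mul_nonneg (adjInd_nonneg G a b) (hF0 G)
    rw [abs_le]
    constructor <;> linarith
  · intro ε hε hb W a b F hW ha hb hab hF hF0
    exact (main W a b F hW ha hb hab hF hF0).2 ε hε ‹_›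

/-- In a random `r`-regular graph on `N ≥ 4 r` vertices, edges have probability `r / N` up to a
relative error `O(1 / r)`, conditionally on any event determined by at most `m` vertices. -/
lemma edgeBound_sparse {m : ℕ} (hr : 2000 * (m + 2) ≤ r) (hN : 4 * r ≤ Fintype.card V) :
    EdgeBound V r m ((48 * m + 1192) / r) := by
  have hr0 : (0 : ℝ) < r := Nat.cast_pos.2 (by omega)
  -- Start with error 1 on `m + 2 j` vertices and contract `j` times, giving up two vertices each
  -- time. The value `48 (m + 4) / r` is stable under the recursion because `24 (m + 2) + 24 (m + 6)
  -- = 48 (m + 4)`.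
  have key : ∀ j : ℕ, ∀ m : ℕ, 400 * (m + 2 * j + 2) ≤ r →
      EdgeBound V r m ((1 / 2) ^ j + 48 * (m + 4) / r) := by
    intro j
    induction j with
    | zero =>
      intro m hm W a b F hW ha hb hab hF hF0
      refine ((edgeBound_step (by omega) hN).1 W a b F hW ha hb hab hF hF0).trans ?_
      refine mul_le_mul_of_nonneg_right ?_ (mul_nonneg (by positivity) (avg_nonneg fun G _ => hF0 G))
      rw [pow_zero]
      have : (0 : ℝ) ≤ 48 * (m + 4) / r := by positivity
      linarith
    | succ j ih =>
      intro m hm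
      have h1 := ih (m + 2) (by omega)
      have h2 := (edgeBound_step (m := m) (by omega) hN).2 _ (by positivity) h1
      convert h2 using 1
      push_cast
      field_simp
      ring
  intro W a b F hW ha hb hab hF hF0
  -- With `j = r / 1000` the requirement `400 (m + 2 j + 2) ≤ r` still holds and `2^(-j) ≤ 1000 /
  -- r`; the constant is `1192 = 1000 + 4 * 48`.
  refine (key (r / 1000) m (by omega) W a b F hW ha hb hab hF hF0).trans ?_
  refine mul_le_mul_of_nonneg_right ?_ (mul_nonneg (by positivity) (avg_nonneg fun G _ => hF0 G))
  have h1 : r < 1000 * 2 ^ (r / 1000) := by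
    have := Nat.lt_two_pow_self (n := r / 1000)
    omega
  have h2 : (r : ℝ) ≤ 1000 * 2 ^ (r / 1000) := by exact_mod_cast h1.le
  have h3 : ((1 : ℝ) / 2) ^ (r / 1000) ≤ 1000 / r := by
    rw [one_div, inv_pow, inv_eq_one_div, div_le_div_iff₀ (by positivity) hr0]
    linarith
  calc ((1 : ℝ) / 2) ^ (r / 1000) + 48 * (m + 4) / r ≤ 1000 / r + 48 * (m + 4) / r := by gcongr
    _ = _ := by ring

end Sparse

/-! ### Cauchy-Schwarz bounds for weighted walks -/

section Bilinear

variable {V : Type*} [Fintype V] (X : V → V → ℝ)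

/-- The number of closed walks of length 4, weighted by a symmetric matrix `X`. -/
def fourCycleSum : ℝ := ∑ c, ∑ c', (∑ e, X c e * X c' e) ^ 2

/-- The number of walks of length 3 from `b` to `a`, weighted by `X`. -/
def threePathSum (a b : V) : ℝ := ∑ c, ∑ e, X b c * X c e * X e a

lemma fourCycleSum_nonneg : 0 ≤ fourCycleSum X :=
  Finset.sum_nonneg fun _ _ => Finset.sum_nonneg fun _ _ => sq_nonneg _

variable {X}

/-- For symmetric `X` both sides are the trace of `X^4`: a closed walk is cut either into two paths
of length 2 or into an edge and a path of length 3. -/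
lemma fourCycleSum_eq (hX : ∀ a b, X a b = X b a) :
    ∑ a, ∑ b, X a b * threePathSum X a b = fourCycleSum X := by
  have h1 : ∀ c c', (∑ e, X c e * X c' e) ^ 2 =
      ∑ e, ∑ e', X c e * (X e c' * X c' e' * X e' c) := by
    intro c c'
    rw [sq, Finset.sum_mul_sum]
    refine Finset.sum_congr rfl fun e _ => Finset.sum_congr rfl fun e' _ => ?_
    rw [hX e c', hX e' c]
    ring
  unfold fourCycleSum threePathSum
  simp only [h1, Finset.mul_sum]
  refine Finset.sum_congr rfl fun a _ => ?_
  rw [Finset.sum_comm]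

/-- The squared length of `Xᵀ g` is the pairing of `g ⊗ g` with `X Xᵀ`, whose squared Frobenius norm
is `fourCycleSum X`; apply Cauchy-Schwarz. -/
lemma sq_sum_sq_le (g : V → ℝ) :
    (∑ e, (∑ c, X c e * g c) ^ 2) ^ 2 ≤ (∑ c, g c ^ 2) ^ 2 * fourCycleSum X := by
  have h1 : ∑ e, (∑ c, X c e * g c) ^ 2 =
      ∑ x : V × V, (g x.1 * g x.2) * (∑ e, X x.1 e * X x.2 e) := by
    rw [Fintype.sum_prod_type]
    simp only [sq, Finset.sum_mul_sum]
    rw [Finset.sum_comm]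
    refine Finset.sum_congr rfl fun c _ => ?_
    rw [Finset.sum_comm]
    refine Finset.sum_congr rfl fun c' _ => ?_
    rw [Finset.mul_sum]
    refine Finset.sum_congr rfl fun e _ => ?_
    ring
  have h2 : (∑ c, g c ^ 2) ^ 2 = ∑ x : V × V, (g x.1 * g x.2) ^ 2 := by
    rw [Fintype.sum_prod_type, sq, Finset.sum_mul_sum]
    simp only [mul_pow]
  have h3 : fourCycleSum X = ∑ x : V × V, (∑ e, X x.1 e * X x.2 e) ^ 2 := by
    rw [Fintype.sum_prod_type, fourCycleSum]
  rw [h1, h2, h3]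
  exact Finset.sum_mul_sq_le_sq_mul_sq _ _ _

lemma bilinear_pow_four_le (g h : V → ℝ) :
    (∑ e, (∑ c, X c e * g c) * h e) ^ 4 ≤
      (∑ c, g c ^ 2) ^ 2 * (∑ e, h e ^ 2) ^ 2 * fourCycleSum X := by
  have h1 : (∑ e, (∑ c, X c e * g c) * h e) ^ 2 ≤
      (∑ e, (∑ c, X c e * g c) ^ 2) * ∑ e, h e ^ 2 := Finset.sum_mul_sq_le_sq_mul_sq _ _ _
  calc (∑ e, (∑ c, X c e * g c) * h e) ^ 4 = ((∑ e, (∑ c, X c e * g c) * h e) ^ 2) ^ 2 := by ring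
    _ ≤ ((∑ e, (∑ c, X c e * g c) ^ 2) * ∑ e, h e ^ 2) ^ 2 := by gcongr
    _ = (∑ e, (∑ c, X c e * g c) ^ 2) ^ 2 * (∑ e, h e ^ 2) ^ 2 := by ring
    _ ≤ ((∑ c, g c ^ 2) ^ 2 * fourCycleSum X) * (∑ e, h e ^ 2) ^ 2 := by
        gcongr; exact sq_sum_sq_le g
    _ = _ := by ring

/-- The bilinear form of walks of length 3 is controlled by the closed walks of length 4. -/
lemma threePathSum_bilinear_le (hX : ∀ a b, X a b = X b a) {u v : V → ℝ} (hu : ∀ a, |u a| ≤ 1)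
    (hv : ∀ a, |v a| ≤ 1) :
    (∑ a, ∑ b, threePathSum X a b * (u a * v b)) ^ 4 ≤
      (Fintype.card V : ℝ) ^ 4 * fourCycleSum X ^ 3 := by
  have hT := fourCycleSum_nonneg X
  have hsq : ∀ {w : V → ℝ}, (∀ a, |w a| ≤ 1) → (∑ c, w c ^ 2) ^ 2 ≤ (Fintype.card V : ℝ) ^ 2 := by
    intro w hw
    gcongr
    have := Finset.sum_le_card_nsmul Finset.univ (fun c => w c ^ 2) 1
      (fun c _ => (sq_le_one_iff_abs_le_one _).2 (hw c))
    simpa using this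
  -- The middle edge of the path is the bilinear form, and the outer two edges act on `v` and `u`.
  -- Each of the three costs one factor `fourCycleSum X` in the fourth power.
  have h1 : ∑ a, ∑ b, threePathSum X a b * (u a * v b) =
      ∑ e, (∑ c, X c e * (∑ b, X b c * v b)) * (∑ a, X a e * u a) := by
    have h2 : ∀ a, ∑ b, threePathSum X a b * (u a * v b) =
        ∑ e, (∑ c, X c e * (∑ b, X b c * v b)) * (X a e * u a) := by
      intro a
      calc _ = ∑ b, ∑ e, ∑ c, X b c * X c e * X e a * (u a * v b) := by
            refine Finset.sum_congr rfl fun b _ => ?_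
            rw [Finset.sum_comm]
            simp only [threePathSum, Finset.sum_mul]
        _ = ∑ e, ∑ c, ∑ b, X b c * X c e * X e a * (u a * v b) := by
            rw [Finset.sum_comm]
            exact Finset.sum_congr rfl fun e _ => Finset.sum_comm
        _ = _ := by
            refine Finset.sum_congr rfl fun e _ => ?_
            rw [Finset.sum_mul]
            refine Finset.sum_congr rfl fun c _ => ?_
            rw [Finset.mul_sum, Finset.sum_mul]
            refine Finset.sum_congr rfl fun b _ => ?_
            rw [hX e a]
            ring
    rw [Finset.sum_congr rfl fun a _ => h2 a, Finset.sum_comm]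
    exact Finset.sum_congr rfl fun e _ => (Finset.mul_sum _ _ _).symm
  rw [h1]
  refine (bilinear_pow_four_le _ _).trans ?_
  calc _ ≤ ((Fintype.card V : ℝ) ^ 2 * fourCycleSum X) * ((Fintype.card V : ℝ) ^ 2 * fourCycleSum X)
        * fourCycleSum X := by
        gcongr
        · exact (sq_sum_sq_le v).trans (mul_le_mul_of_nonneg_right (hsq hv) hT)
        · exact (sq_sum_sq_le u).trans (mul_le_mul_of_nonneg_right (hsq hu) hT)
    _ = _ := by ring

lemma abs_threePathSum_le (hX : ∀ a b, |X a b| ≤ 1) (a b : V) :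
    |threePathSum X a b| ≤ (Fintype.card V : ℝ) ^ 2 := by
  unfold threePathSum
  refine (Finset.abs_sum_le_sum_abs _ _).trans ?_
  have : ∀ c, |∑ e, X b c * X c e * X e a| ≤ (Fintype.card V : ℝ) := by
    intro c
    refine (Finset.abs_sum_le_sum_abs _ _).trans ?_
    have := Finset.sum_le_card_nsmul Finset.univ (fun e => |X b c * X c e * X e a|) 1 (fun e _ => by
      rw [abs_mul, abs_mul]
      exact mul_le_one₀ (mul_le_one₀ (hX _ _) (abs_nonneg _) (hX _ _)) (abs_nonneg _) (hX _ _))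
    simpa using this
  have := Finset.sum_le_card_nsmul Finset.univ _ _ (fun c _ => this c)
  simpa [sq] using this

end Bilinear

/-! ### Dense regime: exchanging an edge deviation for a path -/

section Dense

variable {V : Type*} [Fintype V] {r : ℕ}

/-- The adjacency indicator minus the edge density of an `r`-regular graph. -/
noncomputable def dev (r : ℕ) (G : SimpleGraph V) (a b : V) : ℝ :=
  adjInd G a b - r / Fintype.card V

lemma dev_comm (G : SimpleGraph V) (a b : V) : dev r G a b = dev r G b a := by
  rw [dev, dev, adjInd_comm]

lemma density_mem (hr : r ≤ Fintype.card V) :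
    0 ≤ (r : ℝ) / Fintype.card V ∧ (r : ℝ) / Fintype.card V ≤ 1 :=
  ⟨by positivity, div_le_one_of_le₀ (by exact_mod_cast hr) (by positivity)⟩

lemma abs_dev_le (hr : r ≤ Fintype.card V) (G : SimpleGraph V) (a b : V) : |dev r G a b| ≤ 1 := by
  have h1 := adjInd_nonneg G a b
  have h2 := adjInd_le_one G a b
  have h3 := density_mem hr
  rw [dev, abs_le]
  constructor <;> linarith

lemma abs_dev_mul_le (hr : r ≤ Fintype.card V) (G : SimpleGraph V) (a b : V) {x : ℝ}
    (hx : |x| ≤ 1) : |dev r G a b * x| ≤ 1 := by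
  rw [abs_mul]
  exact mul_le_one₀ (abs_dev_le hr G a b) (abs_nonneg _) hx

lemma dependsOnPairs_dev {S : Set (Sym2 V)} {a b : V} (h : s(a, b) ∈ S) :
    DependsOnPairs S (fun G => dev r G a b) :=
  dependsOnPairs_adjInd_sub h _

/-- Deviations along pendant edges average out. -/
lemma abs_avg_dev_pendant_le [DecidableEq V] {W : Finset V} {F : SimpleGraph V → ℝ}
    (hF : DependsOnPairs (pairsIn W) F) (hF1 : ∀ G, |F G| ≤ 1) {b c : V} (hb : b ∈ W) (hc : c ∉ W)
    (hW : 2 * W.card ≤ Fintype.card V) (hr : r ≤ Fintype.card V) :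
    |avg r (fun G => dev r G b c * F G)| ≤ 2 * W.card / Fintype.card V := by
  have h := avg_pendant (r := r) hF hb hc
  obtain ⟨hp0, hp1⟩ := density_mem hr
  have hW' : 2 * (W.card : ℝ) ≤ Fintype.card V := by exact_mod_cast hW
  have hw1 : (1 : ℝ) ≤ W.card := by exact_mod_cast Finset.card_pos.2 ⟨b, hb⟩
  have hN : (0 : ℝ) < Fintype.card V := by linarith
  have hNw : (0 : ℝ) < Fintype.card V - W.card := by linarith
  -- Centring removes the main term `r`, since `p N = r`; what multiplies `F` is bounded by `|W|`.
  have h1 : ((Fintype.card V : ℝ) - W.card) * avg r (fun G => dev r G b c * F G) =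
      avg r (fun G => (W.card * (r / Fintype.card V : ℝ) - ∑ v ∈ W, adjInd G b v) * F G) := by
    have e1 : avg r (fun G => dev r G b c * F G) =
        avg r (fun G => adjInd G b c * F G) - r / Fintype.card V * avg r F := by
      rw [← avg_const_mul, ← avg_sub]
      exact avg_congr fun G _ => by rw [dev]; ring
    rw [e1, mul_sub, h, ← avg_const_mul, ← avg_const_mul, ← avg_sub]
    refine avg_congr fun G _ => ?_
    field_simp
    ring
  have h2 : |((Fintype.card V : ℝ) - W.card) * avg r (fun G => dev r G b c * F G)| ≤ W.card := by
    rw [h1]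
    refine abs_avg_le (by positivity) fun G _ => ?_
    rw [abs_mul]
    refine (mul_le_of_le_one_right (abs_nonneg _) (hF1 G)).trans ?_
    have h3 := sum_adjInd_le_card G W b
    have h4 : 0 ≤ ∑ v ∈ W, adjInd G b v := Finset.sum_nonneg fun v _ => adjInd_nonneg G b v
    have h5 : (W.card : ℝ) * (r / Fintype.card V) ≤ W.card * 1 := by gcongr
    have h6 : 0 ≤ (W.card : ℝ) * (r / Fintype.card V) := by positivity
    rw [abs_le]
    constructor <;> linarith
  rw [abs_mul, abs_of_pos hNw] at h2
  rw [le_div_iff₀ hN]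
  have h3 := abs_nonneg (avg r (fun G => dev r G b c * F G))
  nlinarith

/-- In a random regular graph, an edge deviation can be exchanged for the deviations along a path
of length 3. -/
lemma abs_avg_dev_add_path_le [DecidableEq V] {W : Finset V} {a b c e : V} {F : SimpleGraph V → ℝ}
    (hF : DependsOnPairs (pairsIn W \ {s(a, b)}) F) (hF1 : ∀ G, |F G| ≤ 1) (ha : a ∈ W) (hb : b ∈ W)
    (hab : a ≠ b) (hc : c ∉ W) (he : e ∉ W) (hce : c ≠ e)
    (hW : 2 * (W.card + 1) ≤ Fintype.card V) (hr : r ≤ Fintype.card V) :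
    |r / Fintype.card V * (1 - r / Fintype.card V) * avg r (fun G => dev r G a b * F G)
      + avg r (fun G => dev r G b c * dev r G c e * dev r G e a * F G)|
      ≤ 16 * (W.card + 1) / Fintype.card V := by
  have hFW : DependsOnPairs (pairsIn W) F := hF.mono Set.sdiff_subset
  have pend : ∀ {F : SimpleGraph V → ℝ} {c e : V}, c ∉ W → e ∉ W → c ≠ e →
      DependsOnPairs (pairsIn (insert e W)) F → (∀ G, |F G| ≤ 1) → ∀ {b : V}, b ∈ insert e W →
      |avg r (fun G => dev r G b c * F G)| ≤ 2 * (W.card + 1) / Fintype.card V := by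
    intro F c e hc he hce hF hF1 b hb
    have hcard := Finset.card_insert_of_notMem he
    have := abs_avg_dev_pendant_le (r := r) hF hF1 hb (c := c) (by simp [hce, hc]) (by omega) hr
    rwa [hcard, Nat.cast_add_one] at this
  have up : ∀ (e : V) {F : SimpleGraph V → ℝ}, DependsOnPairs (pairsIn W) F →
      DependsOnPairs (pairsIn (insert e W)) F :=
    fun e F hF => hF.mono (pairsIn_mono (Finset.subset_insert e W))
  have hx : DependsOnPairs (pairsIn W) (fun G => dev r G a b * F G) :=
    (dependsOnPairs_dev (by simp [ha, hb])).mul hFW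
  have hx1 : ∀ G, |dev r G a b * F G| ≤ 1 := fun G => abs_dev_mul_le hr G a b (hF1 G)
  have tz := pend hc he hce (up e hFW) hF1 (Finset.mem_insert_self e W)
  have ty := pend hc he hce (up e hFW) hF1 (Finset.mem_insert_of_mem hb)
  have tw := pend he hc hce.symm (up c hFW) hF1 (Finset.mem_insert_of_mem ha)
  have txz := pend hc he hce (up e hx) hx1 (Finset.mem_insert_self e W)
  have tyw := pend hc he hce (F := fun G => dev r G a e * F G)
    ((dependsOnPairs_dev (by simp [ha])).mul (up e hFW))
    (fun G => abs_dev_mul_le hr G a e (hF1 G)) (Finset.mem_insert_of_mem hb)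
  have txyz := pend he hc hce.symm (F := fun G => dev r G b c * (dev r G a b * F G))
    ((dependsOnPairs_dev (by simp [hb])).mul (up c hx))
    (fun G => abs_dev_mul_le hr G b c (hx1 G)) (Finset.mem_insert_self c W)
  have hxw : DependsOnPairs (pairsIn (insert e W))
      (fun G => dev r G a e * (dev r G a b * F G)) :=
    (dependsOnPairs_dev (by simp [ha])).mul (up e hx)
  have hxw1 : ∀ G, |dev r G a e * (dev r G a b * F G)| ≤ 1 :=
    fun G => abs_dev_mul_le hr G a e (hx1 G)
  have txzw := pend hc he hce hxw hxw1 (Finset.mem_insert_self e W)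
  have txyw := pend hc he hce hxw hxw1 (Finset.mem_insert_of_mem hb)
  have hsw := avg_switch_cubic (r := r) hF ha hb hab hc he hce
  have hp := density_mem hr
  have hσ0 : 0 ≤ (r : ℝ) / Fintype.card V * (1 - r / Fintype.card V) :=
    mul_nonneg hp.1 (by linarith [hp.2])
  have hσ1 : (r : ℝ) / Fintype.card V * (1 - r / Fintype.card V) ≤ 1 := by nlinarith
  -- The cubic identity expanded around `p`. Every monomial on the right has `c` or `e` as an
  -- endpoint of exactly one factor, so it is a pendant term; there are eight, each with a
  -- coefficient of modulus at most 1.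
  have hsum : r / Fintype.card V * (1 - r / Fintype.card V) * avg r (fun G => dev r G a b * F G)
      + avg r (fun G => dev r G b c * dev r G c e * dev r G e a * F G) =
      - (r / Fintype.card V * (1 - r / Fintype.card V) * (avg r (fun G => dev r G e c * F G)
          - avg r (fun G => dev r G b c * F G) - avg r (fun G => dev r G a e * F G)))
      - (1 - 2 * (r / Fintype.card V)) * (avg r (fun G => dev r G e c * (dev r G a b * F G))
          - avg r (fun G => dev r G b c * (dev r G a e * F G)))
      + avg r (fun G => dev r G c e * (dev r G b c * (dev r G a b * F G)))
      + avg r (fun G => dev r G e c * (dev r G a e * (dev r G a b * F G)))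
      - avg r (fun G => dev r G b c * (dev r G a e * (dev r G a b * F G))) := by
    rw [← sub_eq_zero, ← hsw]
    simp only [← avg_sub, ← avg_add, ← avg_const_mul, ← avg_neg]
    refine avg_congr fun G _ => ?_
    simp only [dev]
    rw [adjInd_comm G e c, adjInd_comm G e a]
    ring
  rw [hsum]
  have e16 : 16 * ((W.card : ℝ) + 1) / Fintype.card V =
      8 * (2 * (W.card + 1) / Fintype.card V) := by ring
  rw [e16]
  generalize 2 * ((W.card : ℝ) + 1) / Fintype.card V = η at *
  generalize (r : ℝ) / Fintype.card V = p at *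
  have hmul : ∀ {s t k : ℝ}, |s| ≤ 1 → |t| ≤ k → |s * t| ≤ k := by
    intro s t k hs ht
    rw [abs_mul]
    exact (mul_le_of_le_one_left (abs_nonneg _) hs).trans ht
  have b1 := hmul (s := p * (1 - p)) (by rw [abs_of_nonneg hσ0]; exact hσ1)
    ((abs_sub _ _).trans (add_le_add ((abs_sub _ _).trans (add_le_add tz ty)) tw))
  have b2 := hmul (s := 1 - 2 * p) (by rw [abs_le]; constructor <;> linarith [hp.1, hp.2])
    ((abs_sub _ _).trans (add_le_add txz tyw))
  rw [abs_le] at *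
  constructor <;> linarith [b1.1, b1.2, b2.1, b2.2, txyz.1, txyz.2, txzw.1, txzw.2, txyw.1, txyw.2]

/-- The trivial bound for the quantity in the previous lemma. -/
lemma abs_avg_dev_add_path_le_two {a b c e : V} {F : SimpleGraph V → ℝ} (hF1 : ∀ G, |F G| ≤ 1)
    (hr : r ≤ Fintype.card V) :
    |r / Fintype.card V * (1 - r / Fintype.card V) * avg r (fun G => dev r G a b * F G)
      + avg r (fun G => dev r G b c * dev r G c e * dev r G e a * F G)| ≤ 2 := by
  have hp := density_mem hr
  rw [← avg_const_mul, ← avg_add]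
  refine abs_avg_le (by norm_num) fun G _ => ?_
  have h1 := abs_dev_mul_le hr G a b (hF1 G)
  have h2 := abs_dev_mul_le hr G b c (abs_dev_mul_le hr G c e (abs_dev_mul_le hr G e a (hF1 G)))
  rw [show dev r G b c * dev r G c e * dev r G e a * F G =
    dev r G b c * (dev r G c e * (dev r G e a * F G)) by ring]
  generalize (r : ℝ) / Fintype.card V = p at *
  refine (abs_add_le _ _).trans ?_
  rw [abs_mul, abs_of_nonneg (mul_nonneg hp.1 (sub_nonneg.2 hp.2))]
  have h3 : p * (1 - p) ≤ 1 := by nlinarith [hp.1, hp.2]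
  have h4 := mul_le_one₀ h3 (abs_nonneg _) h1
  linarith

/-- The interior vertices range over all of `V`, degenerate positions included, so that exact walk
sums appear. -/
lemma sum_avg_dev_add_path (a b : V) (F : SimpleGraph V → ℝ) :
    ∑ c, ∑ e, (r / Fintype.card V * (1 - r / Fintype.card V) * avg r (fun G => dev r G a b * F G)
      + avg r (fun G => dev r G b c * dev r G c e * dev r G e a * F G)) =
    r / Fintype.card V * (1 - r / Fintype.card V) * (Fintype.card V : ℝ) ^ 2 *
        avg r (fun G => dev r G a b * F G)
      + avg r (fun G => threePathSum (dev r G) a b * F G) := by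
  simp only [Finset.sum_add_distrib, Finset.sum_const, Finset.card_univ, nsmul_eq_mul, threePathSum,
    Finset.sum_mul, avg_sum]
  ring

/-- Averaged form of the exchange of an edge for a path of length 3. -/
lemma abs_avg_dev_add_threePathSum_le [DecidableEq V] {W : Finset V} {a b : V} {F : SimpleGraph V → ℝ}
    (hF : DependsOnPairs (pairsIn W \ {s(a, b)}) F) (hF1 : ∀ G, |F G| ≤ 1) (ha : a ∈ W) (hb : b ∈ W)
    (hab : a ≠ b) (hW : 2 * (W.card + 1) ≤ Fintype.card V) (hr : r ≤ Fintype.card V) :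
    |r / Fintype.card V * (1 - r / Fintype.card V) * (Fintype.card V : ℝ) ^ 2 *
        avg r (fun G => dev r G a b * F G)
      + avg r (fun G => threePathSum (dev r G) a b * F G)|
      ≤ (20 * (W.card : ℝ) + 18) * Fintype.card V := by
  rw [← sum_avg_dev_add_path]
  have hN : (0 : ℝ) < Fintype.card V := Nat.cast_pos.2 (by omega)
  -- Degenerate pairs `(c, e)` number only `O(N)` and take the trivial bound 2. Summation gives `16
  -- (|W| + 1) + 4 |W| + 2 = 20 |W| + 18` times `N`.
  have hpt : ∀ c e : V,
      |r / Fintype.card V * (1 - r / Fintype.card V) * avg r (fun G => dev r G a b * F G)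
      + avg r (fun G => dev r G b c * dev r G c e * dev r G e a * F G)| ≤
      16 * (W.card + 1) / Fintype.card V + (if c ∈ W then 2 else 0) + (if e ∈ W then 2 else 0)
        + (if c = e then 2 else 0) := by
    intro c e
    have htriv := abs_avg_dev_add_path_le_two (a := a) (b := b) (c := c) (e := e) hF1 hr
    have h0 : (0 : ℝ) ≤ 16 * (W.card + 1) / Fintype.card V := by positivity
    by_cases hc : c ∈ W
    · rw [if_pos hc]; split_ifs <;> linarith
    by_cases he : e ∈ W
    · rw [if_pos he]; split_ifs <;> linarith
    by_cases hce : c = e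
    · rw [if_pos hce]; split_ifs <;> linarith
    · have := abs_avg_dev_add_path_le hF hF1 ha hb hab hc he hce hW hr
      simpa [hc, he, hce] using this
  refine (Finset.abs_sum_le_sum_abs _ _).trans ((Finset.sum_le_sum fun c _ =>
    (Finset.abs_sum_le_sum_abs _ _).trans (Finset.sum_le_sum fun e _ => hpt c e)).trans ?_)
  simp only [Finset.sum_add_distrib, Finset.sum_const, Finset.card_univ, nsmul_eq_mul,
    Finset.sum_ite_mem, Finset.univ_inter, Finset.sum_ite_eq, Finset.mem_univ, if_true,
    ← Finset.mul_sum]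
  field_simp
  nlinarith

end Dense

/-! ### The mean of the closed walks of length 4 -/

section FourCycles

variable {V : Type*} [Fintype V] {r : ℕ}

lemma sum_dev_path (a b : V) (G : SimpleGraph V) :
    ∑ f, ∑ g, dev r G b f * (dev r G f g * dev r G g a) = threePathSum (dev r G) a b := by
  simp only [threePathSum, mul_assoc]

lemma threePathSum_comap (σ : Equiv.Perm V) (G : SimpleGraph V) (a b : V) :
    threePathSum (dev r (G.comap σ)) a b = threePathSum (dev r G) (σ a) (σ b) := by
  have h : ∀ u v, dev r (G.comap σ) u v = dev r G (σ u) (σ v) := fun u v => rfl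
  unfold threePathSum
  simp only [h]
  rw [Equiv.sum_comp σ (fun c => ∑ e, dev r G (σ b) c * dev r G c (σ e) * dev r G (σ e) (σ a))]
  exact Finset.sum_congr rfl fun c _ =>
    Equiv.sum_comp σ (fun e => dev r G (σ b) c * dev r G c e * dev r G e (σ a))

/-- The closed walks of length 4 weighted by the edge deviations almost cancel on average. -/
lemma avg_fourCycleSum_le (hV : 10 ≤ Fintype.card V) (hr : r ≤ Fintype.card V)
    (hσ : (1 : ℝ) / 8 ≤ r / Fintype.card V * (1 - r / Fintype.card V)) :
    avg r (fun G : SimpleGraph V => fourCycleSum (dev r G)) ≤ 1000 * (Fintype.card V : ℝ) ^ 3 := by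
  classical
  set N : ℝ := (Fintype.card V : ℝ) with hN
  have hN1 : (1 : ℝ) ≤ N := by rw [hN]; exact_mod_cast (by omega : 1 ≤ Fintype.card V)
  set k : ℝ := r / N * (1 - r / N) with hk
  let P : V → V → V → V → SimpleGraph V → ℝ :=
    fun a b f g G => dev r G b f * (dev r G f g * dev r G g a)
  have hP1 : ∀ a b f g G, |P a b f g G| ≤ 1 := fun a b f g G =>
    abs_dev_mul_le hr G b f (abs_dev_mul_le hr G f g (abs_dev_le hr G g a))
  -- The four coincidences excluded are `a = b` and those that could make `ab` one of the pairs
  -- `bf`, `fg`, `ga`; `a = g` and `f = g` are harmless. Four vertices give `20 * 4 + 18 = 98`.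
  have hpt : ∀ a b f g : V, |k * N ^ 2 * avg r (fun G => dev r G a b * P a b f g G)
      + avg r (fun G => threePathSum (dev r G) a b * P a b f g G)| ≤
      98 * N + (if a = b then 2 * N ^ 2 else 0) + (if a = f then 2 * N ^ 2 else 0)
      + (if b = f then 2 * N ^ 2 else 0) + (if b = g then 2 * N ^ 2 else 0) := by
    intro a b f g
    have htriv : |k * N ^ 2 * avg r (fun G => dev r G a b * P a b f g G)
        + avg r (fun G => threePathSum (dev r G) a b * P a b f g G)| ≤ 2 * N ^ 2 := by
      rw [← sum_avg_dev_add_path]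
      refine (Finset.abs_sum_le_sum_abs _ _).trans ((Finset.sum_le_sum fun c _ =>
        (Finset.abs_sum_le_sum_abs _ _).trans (Finset.sum_le_sum fun e _ =>
          abs_avg_dev_add_path_le_two (hP1 a b f g) hr)).trans ?_)
      simp only [Finset.sum_const, Finset.card_univ, nsmul_eq_mul]
      rw [← hN]
      exact le_of_eq (by ring)
    have h0 : 0 ≤ 98 * N := by positivity
    have h0' : 0 ≤ 2 * N ^ 2 := by positivity
    by_cases hab : a = b
    · rw [if_pos hab]; split_ifs <;> linarith
    by_cases haf : a = f
    · rw [if_pos haf]; split_ifs <;> linarith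
    by_cases hbf : b = f
    · rw [if_pos hbf]; split_ifs <;> linarith
    by_cases hbg : b = g
    · rw [if_pos hbg]; split_ifs <;> linarith
    simp only [hab, haf, hbf, hbg, if_false, add_zero]
    have hcard : ({a, b, f, g} : Finset V).card ≤ 4 := Finset.card_le_four
    have hdep : DependsOnPairs (pairsIn {a, b, f, g} \ {s(a, b)}) (P a b f g) := by
      refine (dependsOnPairs_dev ?_).mul ((dependsOnPairs_dev ?_).mul (dependsOnPairs_dev ?_)) <;>
        simp [Ne.symm haf, Ne.symm hbf, hab, hbf, Ne.symm hbg]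
    refine (abs_avg_dev_add_threePathSum_le hdep (hP1 a b f g) (by simp) (by simp) hab (by omega)
      hr).trans ?_
    have hcard' : (({a, b, f, g} : Finset V).card : ℝ) ≤ 4 := by exact_mod_cast hcard
    exact mul_le_mul_of_nonneg_right (by linarith) (by linarith)
  have hsum : ∑ a, ∑ b, ∑ f, ∑ g, (k * N ^ 2 * avg r (fun G => dev r G a b * P a b f g G)
      + avg r (fun G => threePathSum (dev r G) a b * P a b f g G)) =
      k * N ^ 2 * avg r (fun G : SimpleGraph V => fourCycleSum (dev r G)) +
        avg r (fun G : SimpleGraph V => ∑ a, ∑ b, threePathSum (dev r G) a b ^ 2) := by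
    have h1 : ∀ G : SimpleGraph V, fourCycleSum (dev r G) =
        ∑ a, ∑ b, ∑ f, ∑ g, dev r G a b * P a b f g G := by
      intro G
      rw [← fourCycleSum_eq (dev_comm G)]
      refine Finset.sum_congr rfl fun a _ => Finset.sum_congr rfl fun b _ => ?_
      rw [← sum_dev_path]
      simp only [Finset.mul_sum, P]
    have h2 : ∀ G : SimpleGraph V, ∑ a, ∑ b, threePathSum (dev r G) a b ^ 2 =
        ∑ a, ∑ b, ∑ f, ∑ g, threePathSum (dev r G) a b * P a b f g G := by
      intro G
      refine Finset.sum_congr rfl fun a _ => Finset.sum_congr rfl fun b _ => ?_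
      rw [sq]
      nth_rewrite 2 [← sum_dev_path]
      simp only [Finset.mul_sum, P]
    simp only [h1, h2, avg_sum, Finset.mul_sum, Finset.sum_add_distrib]
  have hle : k * N ^ 2 * avg r (fun G : SimpleGraph V => fourCycleSum (dev r G)) +
      avg r (fun G : SimpleGraph V => ∑ a, ∑ b, threePathSum (dev r G) a b ^ 2) ≤ 106 * N ^ 5 := by
    rw [← hsum]
    refine (Finset.sum_le_sum fun a _ => Finset.sum_le_sum fun b _ => Finset.sum_le_sum fun f _ =>
      Finset.sum_le_sum fun g _ => (le_abs_self _).trans (hpt a b f g)).trans ?_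
    simp only [Finset.sum_add_distrib, Finset.sum_const, Finset.card_univ, nsmul_eq_mul,
      Finset.sum_ite_eq, Finset.mem_univ, if_true, ← Finset.mul_sum, ← hN]
    exact le_of_eq (by ring)
  -- This sign is the point: the path sum paired with itself is a sum of squares, so it can be
  -- discarded and the bound falls on the closed walks alone.
  have hpos : 0 ≤ avg r (fun G : SimpleGraph V => ∑ a, ∑ b, threePathSum (dev r G) a b ^ 2) :=
    avg_nonneg fun G _ => Finset.sum_nonneg fun a _ => Finset.sum_nonneg fun b _ => sq_nonneg _
  have hT : 0 ≤ avg r (fun G : SimpleGraph V => fourCycleSum (dev r G)) :=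
    avg_nonneg fun G _ => fourCycleSum_nonneg _
  have h3 : N ^ 2 * (1 / 8 * avg r (fun G : SimpleGraph V => fourCycleSum (dev r G))) ≤
      N ^ 2 * (106 * N ^ 3) := by
    have := mul_le_mul_of_nonneg_right hσ (mul_nonneg (sq_nonneg N) hT)
    nlinarith
  have h4 := le_of_mul_le_mul_left h3 (by positivity)
  have h5 : 0 ≤ N ^ 3 := by positivity
  linarith

end FourCycles

/-! ### Dense regime: decorrelating one edge -/

section Exchange

variable {V : Type*}

open Classical in
/-- The indicator of a proposition, as a real number. -/
noncomputable def propInd (P : Prop) : ℝ := if P then 1 else 0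

lemma propInd_nonneg (P : Prop) : 0 ≤ propInd P := by
  unfold propInd; split_ifs <;> simp

lemma propInd_le_one (P : Prop) : propInd P ≤ 1 := by
  unfold propInd; split_ifs <;> simp

lemma propInd_and (P Q : Prop) : propInd (P ∧ Q) = propInd P * propInd Q := by
  by_cases hP : P <;> by_cases hQ : Q <;> simp [propInd, hP, hQ]

lemma propInd_not (P : Prop) : propInd (¬ P) = 1 - propInd P := by
  by_cases hP : P <;> simp [propInd, hP]

lemma propInd_true : propInd True = 1 := by simp [propInd]

/-- The indicator that a vertex is adjacent to all vertices of `S`. -/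
noncomputable def adjAll (S : Finset V) (G : SimpleGraph V) (a : V) : ℝ :=
  propInd (∀ v ∈ S, G.Adj a v)

lemma adjAll_congr {S : Finset V} {G G' : SimpleGraph V} {a a' : V}
    (h : ∀ v ∈ S, G.Adj a v ↔ G'.Adj a' v) : adjAll S G a = adjAll S G' a' :=
  congrArg propInd (propext (forall₂_congr h))

lemma abs_adjAll_le (S : Finset V) (G : SimpleGraph V) (a : V) : |adjAll S G a| ≤ 1 := by
  rw [adjAll, abs_of_nonneg (propInd_nonneg _)]
  exact propInd_le_one _

lemma dependsOnPairs_adjAll {S : Finset V} {a : V} {E : Set (Sym2 V)}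
    (h : ∀ v ∈ S, s(a, v) ∈ E) : DependsOnPairs E (fun G => adjAll S G a) := by
  intro G G' hG
  exact adjAll_congr fun v hv => by simpa using hG _ (h v hv)

variable [Fintype V] {r : ℕ}

/-- A path of length 3 between two vertices, jointly with a pattern in which these two vertices
play separate roles, has a small average deviation. -/
lemma abs_avg_threePathSum_le {W S S' : Finset V} (hS : S ⊆ W) (hS' : S' ⊆ W)
    {F : SimpleGraph V → ℝ} (hF : DependsOnPairs (pairsIn W) F) (hF1 : ∀ G, |F G| ≤ 1)
    {a b : V} (ha : a ∉ W) (hb : b ∉ W) (hab : a ≠ b) {ν : ℝ} (hν : 1 ≤ ν)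
    (hνV : ν ^ 4 = Fintype.card V) (hr : r ≤ Fintype.card V)
    (hT : avg r (fun G : SimpleGraph V => fourCycleSum (dev r G)) ≤
      1000 * (Fintype.card V : ℝ) ^ 3) :
    |avg r (fun G => threePathSum (dev r G) a b * (adjAll S G a * adjAll S' G b * F G))| ≤
      (4 * W.card + 1005) * ν ^ 5 := by
  classical
  have hν0 : 0 < ν := by linarith
  have hN0 : (0 : ℝ) < Fintype.card V := by rw [← hνV]; positivity
  let Ψ : V → V → ℝ := fun a b =>
    avg r (fun G => threePathSum (dev r G) a b * (adjAll S G a * adjAll S' G b * F G))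
  have hmulK : ∀ a b G, |adjAll S G a * adjAll S' G b * F G| ≤ 1 := by
    intro a b G
    rw [abs_mul, abs_mul]
    exact mul_le_one₀ (mul_le_one₀ (abs_adjAll_le _ _ _) (abs_nonneg _) (abs_adjAll_le _ _ _))
      (abs_nonneg _) (hF1 G)
  have hΨ : ∀ a b, |Ψ a b| ≤ (Fintype.card V : ℝ) ^ 2 := by
    intro a b
    refine abs_avg_le (by positivity) fun G _ => ?_
    rw [abs_mul]
    exact (mul_le_of_le_one_right (abs_nonneg _) (hmulK a b G)).trans
      (abs_threePathSum_le (abs_dev_le hr G) a b)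
  have hall : ∀ {S : Finset V}, S ⊆ W → ∀ {c c' : V}, c ∉ W → c' ∉ W → ∀ (G : SimpleGraph V)
      (u : V), adjAll S (G.comap (Equiv.swap c c')) u = adjAll S G (Equiv.swap c c' u) := by
    intro S hS c c' hc hc' G u
    refine adjAll_congr fun v hv => ?_
    have hvc : v ≠ c := by rintro rfl; exact hc (hS hv)
    have hvc' : v ≠ c' := by rintro rfl; exact hc' (hS hv)
    rw [SimpleGraph.comap_adj, Equiv.swap_apply_of_ne_of_ne hvc hvc']
  have hswap : ∀ {c c' : V}, c ∉ W → c' ∉ W → ∀ u v,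
      Ψ u v = Ψ (Equiv.swap c c' u) (Equiv.swap c c' v) := by
    intro c c' hc hc' u v
    refine (avg_comap (Equiv.swap c c') _).symm.trans (avg_congr fun G _ => ?_)
    rw [threePathSum_comap, hall hS hc hc', hall hS' hc hc', hF.comap_swap hc hc']
  -- Transpose first `a` with `a'`, then `b` with `b'`. The exclusions ensure that neither
  -- transposition moves the other endpoint or `W`.
  have hΨeq : ∀ a' b' : V, a' ∉ insert b W → b' ∉ insert a' W → Ψ a b = Ψ a' b' := by
    intro a' b' ha' hb'
    rw [Finset.mem_insert, not_or] at ha' hb'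
    rw [hswap ha ha'.2 a b, Equiv.swap_apply_left,
      Equiv.swap_apply_of_ne_of_ne hab.symm (Ne.symm ha'.1), hswap hb hb'.2 a' b,
      Equiv.swap_apply_left, Equiv.swap_apply_of_ne_of_ne ha'.1 (Ne.symm hb'.1)]
  have hdiff : |∑ a', ∑ b', (Ψ a b - Ψ a' b')| ≤
      4 * (W.card + 1) * (Fintype.card V : ℝ) ^ 3 := by
    have hpt : ∀ a' b' : V, |Ψ a b - Ψ a' b'| ≤
        (if a' ∈ insert b W then 2 * (Fintype.card V : ℝ) ^ 2 else 0)
          + (if b' ∈ insert a' W then 2 * (Fintype.card V : ℝ) ^ 2 else 0) := by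
      intro a' b'
      have h0 : 0 ≤ 2 * (Fintype.card V : ℝ) ^ 2 := by positivity
      have htriv : |Ψ a b - Ψ a' b'| ≤ 2 * (Fintype.card V : ℝ) ^ 2 :=
        (abs_sub _ _).trans (by linarith [hΨ a b, hΨ a' b'])
      by_cases h1 : a' ∈ insert b W
      · rw [if_pos h1]; split_ifs <;> linarith
      by_cases h2 : b' ∈ insert a' W
      · rw [if_pos h2]; split_ifs; linarith
      rw [hΨeq a' b' h1 h2, sub_self, abs_zero]
      split_ifs; simp
    refine (Finset.abs_sum_le_sum_abs _ _).trans ((Finset.sum_le_sum fun c _ =>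
      (Finset.abs_sum_le_sum_abs _ _).trans (Finset.sum_le_sum fun e _ => hpt c e)).trans ?_)
    simp only [Finset.sum_add_distrib, Finset.sum_const, Finset.card_univ, nsmul_eq_mul,
      Finset.sum_ite_mem, Finset.univ_inter, ← Finset.mul_sum]
    have hins : ∀ x : V, ((insert x W).card : ℝ) ≤ W.card + 1 := fun x => by
      exact_mod_cast Finset.card_insert_le x W
    calc _ ≤ (Fintype.card V : ℝ) * ((W.card + 1) * (2 * (Fintype.card V : ℝ) ^ 2)) +
          ∑ x : V, (W.card + 1) * (2 * (Fintype.card V : ℝ) ^ 2) := by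
          gcongr <;> exact hins _
      _ = _ := by
          simp only [Finset.sum_const, Finset.card_univ, nsmul_eq_mul]
          ring
  -- With `T = ν^12 x` the bilinear bound is `ν^13 x^(3/4)`. Replacing `x^(3/4)` by `1 + x` makes it
  -- linear in `T`, so only the mean of `T` is needed.
  have hpow : ∀ G : SimpleGraph V, |∑ a', ∑ b', threePathSum (dev r G) a' b' *
      (adjAll S G a' * adjAll S' G b')| ≤ ν ^ 13 * (1 + fourCycleSum (dev r G) / ν ^ 12) := by
    intro G
    have h := threePathSum_bilinear_le (dev_comm (r := r) G) (abs_adjAll_le S G)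
      (abs_adjAll_le S' G)
    have hT0 := fourCycleSum_nonneg (dev r G)
    generalize fourCycleSum (dev r G) = T at *
    set x := T / ν ^ 12 with hx
    have hx0 : 0 ≤ x := by positivity
    have hTx : T = ν ^ 12 * x := by rw [hx]; field_simp
    refine (pow_le_pow_iff_left₀ (abs_nonneg _) (by positivity) (by norm_num : 4 ≠ 0)).1 ?_
    rw [pow_abs, abs_of_nonneg (by positivity)]
    refine h.trans ?_
    rw [← hνV, hTx]
    calc (ν ^ 4) ^ 4 * (ν ^ 12 * x) ^ 3 = ν ^ 52 * x ^ 3 := by ring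
      _ ≤ ν ^ 52 * (1 + x) ^ 4 := by
          gcongr
          calc x ^ 3 ≤ (1 + x) ^ 3 := by gcongr; linarith
            _ ≤ (1 + x) ^ 4 := pow_le_pow_right₀ (by linarith) (by norm_num)
      _ = _ := by ring
  -- For fixed `G` the factors `adjAll` are bounded vectors in `a'` and in `b'` separately, and `F`
  -- involves neither; this is the shape the bilinear bound requires.
  have hsum : |∑ a', ∑ b', Ψ a' b'| ≤ 1001 * ν ^ 13 := by
    have h1 : ∑ a', ∑ b', Ψ a' b' = avg r (fun G => (∑ a', ∑ b', threePathSum (dev r G) a' b' *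
        (adjAll S G a' * adjAll S' G b')) * F G) := by
      simp only [Finset.sum_mul, avg_sum, Ψ, mul_assoc]
    rw [h1]
    refine (abs_avg_le_avg_abs _).trans ?_
    calc _ ≤ avg r (fun G : SimpleGraph V => ν ^ 13 + ν * fourCycleSum (dev r G)) := by
          refine avg_mono fun G _ => ?_
          rw [abs_mul]
          refine (mul_le_of_le_one_right (abs_nonneg _) (hF1 G)).trans ((hpow G).trans ?_)
          refine le_of_eq ?_
          field_simp
      _ ≤ ν ^ 13 + ν * (1000 * (Fintype.card V : ℝ) ^ 3) := by
          rw [avg_add, avg_const_mul]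
          gcongr
          exact avg_const_le (by positivity)
      _ = _ := by rw [← hνV]; ring
  have hfin : (Fintype.card V : ℝ) ^ 2 * |Ψ a b| ≤
      1001 * ν ^ 13 + 4 * (W.card + 1) * (Fintype.card V : ℝ) ^ 3 := by
    have h1 : (Fintype.card V : ℝ) ^ 2 * Ψ a b =
        (∑ a', ∑ b', Ψ a' b') + ∑ a', ∑ b', (Ψ a b - Ψ a' b') := by
      simp only [Finset.sum_sub_distrib, Finset.sum_const, Finset.card_univ, nsmul_eq_mul]
      ring
    rw [← abs_of_pos (pow_pos hN0 2), ← abs_mul, h1]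
    exact (abs_add_le _ _).trans (add_le_add hsum hdiff)
  have h8 : 0 < ν ^ 8 := by positivity
  refine le_of_mul_le_mul_left ?_ h8
  rw [← hνV] at hfin
  have h12 : ν ^ 12 ≤ ν ^ 13 := pow_le_pow_right₀ hν (by norm_num)
  have hw : 4 * ((W.card : ℝ) + 1) * ν ^ 12 ≤ 4 * (W.card + 1) * ν ^ 13 := by gcongr
  calc ν ^ 8 * |Ψ a b| = (ν ^ 4) ^ 2 * |Ψ a b| := by ring
    _ ≤ 1001 * ν ^ 13 + 4 * (W.card + 1) * (ν ^ 4) ^ 3 := hfin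
    _ = 1001 * ν ^ 13 + 4 * (W.card + 1) * ν ^ 12 := by ring
    _ ≤ 1001 * ν ^ 13 + 4 * (W.card + 1) * ν ^ 13 := by linarith
    _ = _ := by ring

/-- In a dense random regular graph, an edge is almost uncorrelated with any pattern on the
other pairs of a bounded set of vertices. -/
lemma abs_avg_dev_le {W S S' : Finset V} (hS : S ⊆ W) (hS' : S' ⊆ W)
    {F : SimpleGraph V → ℝ} (hF : DependsOnPairs (pairsIn W) F) (hF1 : ∀ G, |F G| ≤ 1)
    {a b : V} (ha : a ∉ W) (hb : b ∉ W) (hab : a ≠ b) {ν : ℝ} (hν : 1 ≤ ν)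
    (hνV : ν ^ 4 = Fintype.card V) (hr : r ≤ Fintype.card V) (hV : 10 ≤ Fintype.card V)
    (hW : 2 * (W.card + 3) ≤ Fintype.card V)
    (hσ : (1 : ℝ) / 8 ≤ r / Fintype.card V * (1 - r / Fintype.card V)) :
    |avg r (fun G => dev r G a b * (adjAll S G a * adjAll S' G b * F G))| ≤
      8 * (24 * W.card + 1063) / ν ^ 3 := by
  classical
  have hν0 : 0 < ν := by linarith
  have h1 := abs_avg_threePathSum_le hS hS' hF hF1 ha hb hab hν hνV hr
    (avg_fourCycleSum_le hV hr hσ)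
  have hcard : (insert a (insert b W)).card = W.card + 2 := by
    rw [Finset.card_insert_of_notMem (by simp [hab, ha]), Finset.card_insert_of_notMem hb]
  have hK1 : ∀ G, |adjAll S G a * adjAll S' G b * F G| ≤ 1 := by
    intro G
    rw [abs_mul, abs_mul]
    exact mul_le_one₀ (mul_le_one₀ (abs_adjAll_le _ _ _) (abs_nonneg _) (abs_adjAll_le _ _ _))
      (abs_nonneg _) (hF1 G)
  have hne : ∀ {v : V}, v ∈ W → v ≠ a ∧ v ≠ b :=
    fun hv => ⟨fun h => ha (h ▸ hv), fun h => hb (h ▸ hv)⟩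
  have hdep : DependsOnPairs (pairsIn (insert a (insert b W)) \ {s(a, b)})
      (fun G => adjAll S G a * adjAll S' G b * F G) := by
    refine ((dependsOnPairs_adjAll ?_).mul (dependsOnPairs_adjAll ?_)).mul (hF.mono ?_)
    · intro v hv
      refine ⟨mk_mem_pairsIn.2 ⟨by simp, Finset.mem_insert_of_mem (Finset.mem_insert_of_mem (hS hv))⟩, fun h => ?_⟩
      have := hne (hS hv)
      rw [Set.mem_singleton_iff, Sym2.eq_iff] at h
      tauto
    · intro v hv
      refine ⟨mk_mem_pairsIn.2 ⟨by simp, Finset.mem_insert_of_mem (Finset.mem_insert_of_mem (hS' hv))⟩, fun h => ?_⟩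
      have := hne (hS' hv)
      rw [Set.mem_singleton_iff, Sym2.eq_iff] at h
      tauto
    · intro x hx
      refine ⟨pairsIn_mono (by intro y; simp; tauto) hx, ?_⟩
      rintro rfl
      exact ha (mk_mem_pairsIn.1 hx).1
  have h2 := abs_avg_dev_add_threePathSum_le (r := r) hdep hK1 (by simp) (by simp) hab
    (by rw [hcard]; omega) hr
  rw [hcard] at h2
  rw [le_div_iff₀ (by positivity)]
  generalize avg r (fun G => dev r G a b * (adjAll S G a * adjAll S' G b * F G)) = D at *
  generalize avg r (fun G => threePathSum (dev r G) a b *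
    (adjAll S G a * adjAll S' G b * F G)) = Q at *
  generalize (r : ℝ) / Fintype.card V * (1 - r / Fintype.card V) = k at *
  rw [← hνV] at h2
  -- Here `(20 (|W| + 2) + 18) + (4 |W| + 1005) = 24 |W| + 1063`. Division by `k ν^8` with `k ≥ 1/8`
  -- leaves order `ν^(-3) = N^(-3/4)`.
  have h3 : |k * (ν ^ 4) ^ 2 * D| ≤ (24 * W.card + 1063) * ν ^ 5 := by
    have e1 : k * (ν ^ 4) ^ 2 * D = (k * (ν ^ 4) ^ 2 * D + Q) - Q := by ring
    rw [e1]
    refine (abs_sub _ _).trans ((add_le_add h2 h1).trans ?_)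
    have h45 : ν ^ 4 ≤ ν ^ 5 := pow_le_pow_right₀ hν (by norm_num)
    push_cast
    have hw : (20 * ((W.card : ℝ) + 2) + 18) * ν ^ 4 ≤ (20 * (W.card + 2) + 18) * ν ^ 5 :=
      mul_le_mul_of_nonneg_left h45 (by linarith [Nat.cast_nonneg (α := ℝ) W.card])
    linarith
  rw [abs_mul, abs_mul, abs_of_pos (by linarith : 0 < k), abs_of_pos (by positivity)] at h3
  have h5 : 0 < ν ^ 5 := by positivity
  refine le_of_mul_le_mul_right ?_ h5
  have h6 : 1 / 8 * ((ν ^ 4) ^ 2 * |D|) ≤ k * ((ν ^ 4) ^ 2 * |D|) :=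
    mul_le_mul_of_nonneg_right hσ (by positivity)
  linarith

end Exchange

/-! ### Pattern probabilities and the union of the regimes -/

section Patterns

variable {V : Type*}

/-- The indicator that all pairs in `s` are edges. -/
noncomputable def edgeInd (s : Finset (Sym2 V)) (G : SimpleGraph V) : ℝ :=
  propInd (∀ e ∈ s, e ∈ G.edgeSet)

/-- The indicator that no pair in `s` is an edge. -/
noncomputable def nonedgeInd (s : Finset (Sym2 V)) (G : SimpleGraph V) : ℝ :=
  propInd (∀ e ∈ s, e ∉ G.edgeSet)

lemma edgeInd_nonneg (s : Finset (Sym2 V)) (G : SimpleGraph V) : 0 ≤ edgeInd s G :=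
  propInd_nonneg _

lemma edgeInd_le_one (s : Finset (Sym2 V)) (G : SimpleGraph V) : edgeInd s G ≤ 1 :=
  propInd_le_one _

lemma nonedgeInd_nonneg (s : Finset (Sym2 V)) (G : SimpleGraph V) : 0 ≤ nonedgeInd s G :=
  propInd_nonneg _

lemma nonedgeInd_le_one (s : Finset (Sym2 V)) (G : SimpleGraph V) : nonedgeInd s G ≤ 1 :=
  propInd_le_one _

lemma dependsOnPairs_edgeInd {s : Finset (Sym2 V)} {E : Set (Sym2 V)} (h : ∀ e ∈ s, e ∈ E) :
    DependsOnPairs E (edgeInd s) := fun _ _ hG =>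
  congrArg propInd (propext (forall₂_congr fun e he => hG e (h e he)))

lemma dependsOnPairs_nonedgeInd {s : Finset (Sym2 V)} {E : Set (Sym2 V)} (h : ∀ e ∈ s, e ∈ E) :
    DependsOnPairs E (nonedgeInd s) := fun _ _ hG =>
  congrArg propInd (propext (forall₂_congr fun e he => not_congr (hG e (h e he))))

lemma edgeInd_insert [DecidableEq V] (a b : V) (s : Finset (Sym2 V)) (G : SimpleGraph V) :
    edgeInd (insert s(a, b) s) G = adjInd G a b * edgeInd s G := by
  rw [edgeInd, Finset.forall_mem_insert, propInd_and]
  rfl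

lemma nonedgeInd_insert [DecidableEq V] (a b : V) (s : Finset (Sym2 V)) (G : SimpleGraph V) :
    nonedgeInd (insert s(a, b) s) G = nonedgeInd s G - adjInd G a b * nonedgeInd s G := by
  rw [nonedgeInd, Finset.forall_mem_insert, propInd_and, propInd_not, sub_mul, one_mul]
  rfl

/-- The pairs of a pattern that meet `{a, b}` split off. -/
lemma edgeInd_eq_adjAll_mul [DecidableEq V] {W : Finset V} {s : Finset (Sym2 V)}
    (hs : ∀ e ∈ s, e ∈ pairsIn W ∧ ¬ e.IsDiag) {a b : V} (hab : s(a, b) ∉ s)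
    (G : SimpleGraph V) :
    edgeInd s G = adjAll ((W \ {a, b}).filter fun v => s(a, v) ∈ s) G a *
      adjAll ((W \ {a, b}).filter fun v => s(b, v) ∈ s) G b *
      edgeInd (s.filter fun e => a ∉ e ∧ b ∉ e) G := by
  have key : (∀ e ∈ s, e ∈ G.edgeSet) ↔
      ((∀ v ∈ (W \ {a, b}).filter fun v => s(a, v) ∈ s, G.Adj a v) ∧
      (∀ v ∈ (W \ {a, b}).filter fun v => s(b, v) ∈ s, G.Adj b v)) ∧
      ∀ e ∈ s.filter fun e => a ∉ e ∧ b ∉ e, e ∈ G.edgeSet := by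
    simp only [Finset.mem_filter]
    constructor
    · exact fun h => ⟨⟨fun v hv => h _ hv.2, fun v hv => h _ hv.2⟩, fun e he => h e he.1⟩
    · rintro ⟨⟨h1, h2⟩, h3⟩ e he
      have hcase : ∀ x : V, (x = a ∨ x = b) → x ∈ e → e ∈ G.edgeSet := by
        intro x hx hxe
        obtain ⟨v, rfl⟩ := Sym2.mem_iff_exists.1 hxe
        obtain ⟨hW, hd⟩ := hs _ he
        rw [mk_mem_pairsIn] at hW
        rw [Sym2.mk_isDiag_iff] at hd
        rw [SimpleGraph.mem_edgeSet]
        rcases hx with rfl | rfl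
        · refine h1 v ⟨?_, he⟩
          have : v ≠ b := by rintro rfl; exact hab he
          simp [hW.2, this, Ne.symm hd]
        · refine h2 v ⟨?_, he⟩
          have : v ≠ a := by rintro rfl; exact hab (Sym2.eq_swap ▸ he)
          simp [hW.2, this, Ne.symm hd]
      by_cases ha : a ∈ e
      · exact hcase a (Or.inl rfl) ha
      by_cases hb : b ∈ e
      · exact hcase b (Or.inr rfl) hb
      exact h3 e ⟨he, ha, hb⟩
  rw [edgeInd, key, propInd_and, propInd_and]
  rfl

variable [Fintype V] {r : ℕ}

lemma avg_edgeInd_empty (h : (regSet V r).Nonempty) : avg r (edgeInd (∅ : Finset (Sym2 V))) = 1 := by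
  rw [← avg_const h 1]
  exact avg_congr fun G _ => by simp [edgeInd, propInd_true]

lemma avg_nonedgeInd_empty (h : (regSet V r).Nonempty) :
    avg r (nonedgeInd (∅ : Finset (Sym2 V))) = 1 := by
  rw [← avg_const h 1]
  exact avg_congr fun G _ => by simp [nonedgeInd, propInd_true]

/-- Pattern probabilities in sparse random regular graphs. -/
lemma abs_avg_edgeInd_sub_le_of_sparse {m : ℕ} (hr : 2000 * (m + 2) ≤ r)
    (hN : 4 * r ≤ Fintype.card V) (hne : (regSet V r).Nonempty) {W : Finset V} (hW : W.card ≤ m)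
    (s : Finset (Sym2 V)) (hs : ∀ e ∈ s, e ∈ pairsIn W ∧ ¬ e.IsDiag) :
    |avg r (edgeInd s) - (r / Fintype.card V : ℝ) ^ s.card| ≤
      ((48 * m + 1193) ^ s.card - 1) / r * (r / Fintype.card V : ℝ) ^ s.card := by
  classical
  have hr1 : (1 : ℝ) ≤ r := Nat.one_le_cast.2 (by omega)
  have hr0 : (0 : ℝ) < r := by linarith
  have hp0 : (0 : ℝ) ≤ r / Fintype.card V := by positivity
  induction s using Finset.induction_on with
  | empty => simp [avg_edgeInd_empty hne]
  | insert e s he ih =>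
    have ih := ih fun e he => hs e (Finset.mem_insert_of_mem he)
    induction e with | _ a b => ?_
    obtain ⟨hab, hd⟩ := hs _ (Finset.mem_insert_self _ s)
    rw [mk_mem_pairsIn] at hab
    rw [Sym2.mk_isDiag_iff] at hd
    have h1 := edgeBound_sparse hr hN W a b (edgeInd s) hW hab.1 hab.2 hd
      (dependsOnPairs_edgeInd fun e he' => ⟨(hs e (Finset.mem_insert_of_mem he')).1, by
        rintro rfl; exact he he'⟩) (edgeInd_nonneg s)
    rw [Finset.card_insert_of_notMem he]
    rw [funext (edgeInd_insert a b s)]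
    have hE : 0 ≤ avg r (edgeInd s) := avg_nonneg fun G _ => edgeInd_nonneg s G
    generalize avg r (edgeInd s) = E at *
    generalize avg r (fun G => adjInd G a b * edgeInd s G) = E1 at *
    generalize (r / Fintype.card V : ℝ) = p at *
    have hK : (0 : ℝ) ≤ 48 * m + 1192 := by positivity
    have hK' : (48 * m + 1193 : ℝ) = (48 * m + 1192) + 1 := by ring
    rw [hK'] at ih ⊢
    generalize (48 * m + 1192 : ℝ) = K at *
    generalize s.card = n at *
    have hC0 : 0 ≤ (K + 1) ^ n - 1 := sub_nonneg.2 (one_le_pow₀ (by linarith))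
    -- The error constants satisfy `C_(n+1) = C_n + K (K + 1)^n`, solved by `C_n = (K + 1)^n - 1`.
    have hEle : E ≤ (K + 1) ^ n * p ^ n := by
      have h2 : ((K + 1) ^ n - 1) / r ≤ (K + 1) ^ n - 1 := div_le_self hC0 hr1
      have h3 := mul_le_mul_of_nonneg_right h2 (pow_nonneg hp0 n)
      linarith [(abs_le.1 ih).2]
    calc |E1 - p ^ (n + 1)| = |(E1 - p * E) + p * (E - p ^ n)| := by ring_nf
      _ ≤ |E1 - p * E| + p * |E - p ^ n| := by
          refine (abs_add_le _ _).trans ?_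
          rw [abs_mul, abs_of_nonneg hp0]
      _ ≤ K / r * (p * ((K + 1) ^ n * p ^ n)) + p * (((K + 1) ^ n - 1) / r * p ^ n) := by
          gcongr
          refine h1.trans ?_
          gcongr
      _ = _ := by ring

/-- Probabilities of sets of non-edges in sparse random regular graphs. -/
lemma abs_avg_nonedgeInd_sub_le_of_sparse {m : ℕ} (hr : 2000 * (m + 2) ≤ r)
    (hN : 4 * r ≤ Fintype.card V) (hne : (regSet V r).Nonempty) {W : Finset V} (hW : W.card ≤ m)
    (s : Finset (Sym2 V)) (hs : ∀ e ∈ s, e ∈ pairsIn W ∧ ¬ e.IsDiag) :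
    |avg r (nonedgeInd s) - (1 - r / Fintype.card V : ℝ) ^ s.card| ≤
      s.card * ((48 * m + 1192) / Fintype.card V) := by
  classical
  have hr1 : (1 : ℝ) ≤ r := Nat.one_le_cast.2 (by omega)
  have hr0 : (0 : ℝ) < r := by linarith
  have hp0 : (0 : ℝ) ≤ r / Fintype.card V := by positivity
  have hp1 := (density_mem (V := V) (r := r) (by omega)).2
  induction s using Finset.induction_on with
  | empty => simp [avg_nonedgeInd_empty hne]
  | insert e s he ih =>
    have ih := ih fun e he => hs e (Finset.mem_insert_of_mem he)
    induction e with | _ a b => ?_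
    obtain ⟨hab, hd⟩ := hs _ (Finset.mem_insert_self _ s)
    rw [mk_mem_pairsIn] at hab
    rw [Sym2.mk_isDiag_iff] at hd
    have h1 := edgeBound_sparse hr hN W a b (nonedgeInd s) hW hab.1 hab.2 hd
      (dependsOnPairs_nonedgeInd fun e he' => ⟨(hs e (Finset.mem_insert_of_mem he')).1, by
        rintro rfl; exact he he'⟩) (nonedgeInd_nonneg s)
    rw [Finset.card_insert_of_notMem he]
    rw [funext (nonedgeInd_insert a b s), avg_sub]
    have hE1 : avg r (nonedgeInd s) ≤ 1 :=
      (avg_mono fun G _ => nonedgeInd_le_one s G).trans (avg_const_le zero_le_one)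
    -- The relative error `K / r` of an edge of density `r / N` becomes an absolute error `K / N`,
    -- free of `r`. So the complement may have slowly growing degree.
    rw [← mul_assoc, div_mul_div_cancel₀ hr0.ne'] at h1
    generalize avg r (nonedgeInd s) = E at *
    generalize avg r (fun G => adjInd G a b * nonedgeInd s G) = E1 at *
    generalize (r / Fintype.card V : ℝ) = p at *
    have hK : (0 : ℝ) ≤ (48 * m + 1192) / Fintype.card V := by positivity
    generalize (48 * m + 1192 : ℝ) / Fintype.card V = K at *
    generalize s.card = n at *
    calc |E - E1 - (1 - p) ^ (n + 1)| = |(1 - p) * (E - (1 - p) ^ n) - (E1 - p * E)| := by ring_nf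
      _ ≤ (1 - p) * |E - (1 - p) ^ n| + |E1 - p * E| := by
          refine (abs_sub _ _).trans ?_
          rw [abs_mul, abs_of_nonneg (sub_nonneg.2 hp1)]
      _ ≤ 1 * (n * K) + K * 1 := by
          refine add_le_add (mul_le_mul (by linarith) ih (abs_nonneg _) zero_le_one) ?_
          exact h1.trans (mul_le_mul_of_nonneg_left hE1 hK)
      _ = _ := by push_cast; ring

/-- Pattern probabilities in dense random regular graphs. -/
lemma abs_avg_edgeInd_sub_le_of_dense {m : ℕ} {ν : ℝ} (hν : 1 ≤ ν)
    (hνV : ν ^ 4 = Fintype.card V) (hr : r ≤ Fintype.card V) (hV : 2 * (m + 5) ≤ Fintype.card V)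
    (hσ : (1 : ℝ) / 8 ≤ r / Fintype.card V * (1 - r / Fintype.card V))
    (hne : (regSet V r).Nonempty) {W : Finset V} (hW : W.card ≤ m)
    (s : Finset (Sym2 V)) (hs : ∀ e ∈ s, e ∈ pairsIn W ∧ ¬ e.IsDiag) :
    |avg r (edgeInd s) - (r / Fintype.card V : ℝ) ^ s.card| ≤
      s.card * (8 * (24 * m + 1063) / ν ^ 3) := by
  classical
  obtain ⟨hp0, hp1⟩ := density_mem hr
  have hν0 : 0 < ν := by linarith
  induction s using Finset.induction_on with
  | empty => simp [avg_edgeInd_empty hne]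
  | insert e s he ih =>
    have hs' : ∀ e ∈ s, e ∈ pairsIn W ∧ ¬ e.IsDiag := fun e he => hs e (Finset.mem_insert_of_mem he)
    have ih := ih hs'
    induction e with | _ a b => ?_
    obtain ⟨hab, hd⟩ := hs _ (Finset.mem_insert_self _ s)
    rw [mk_mem_pairsIn] at hab
    rw [Sym2.mk_isDiag_iff] at hd
    have hcard : (W \ {a, b}).card ≤ m := (Finset.card_le_card Finset.sdiff_subset).trans hW
    have hdep : DependsOnPairs (pairsIn (W \ {a, b}))
        (edgeInd (s.filter fun e => a ∉ e ∧ b ∉ e)) := by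
      refine dependsOnPairs_edgeInd fun e he' v hv => ?_
      rw [Finset.mem_filter] at he'
      have : v ∈ W := (hs' e he'.1).1 v hv
      rw [Finset.mem_sdiff, Finset.mem_insert, Finset.mem_singleton, not_or]
      refine ⟨this, ?_, ?_⟩
      · rintro rfl; exact he'.2.1 hv
      · rintro rfl; exact he'.2.2 hv
    -- The pairs of `s` at `a` and at `b` become the two `adjAll` factors; the remaining pairs live
    -- on `W \ {a, b}`.
    have h1 := abs_avg_dev_le (r := r) (S := (W \ {a, b}).filter fun v => s(a, v) ∈ s)
      (S' := (W \ {a, b}).filter fun v => s(b, v) ∈ s) (Finset.filter_subset _ _)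
      (Finset.filter_subset _ _) hdep
      (fun G => by rw [abs_of_nonneg (edgeInd_nonneg _ _)]; exact edgeInd_le_one _ _)
      (a := a) (b := b) (by simp) (by simp) hd hν hνV hr (by omega) (by omega) hσ
    have h2 : avg r (fun G => dev r G a b * edgeInd s G) =
        avg r (fun G => adjInd G a b * edgeInd s G) - r / Fintype.card V * avg r (edgeInd s) := by
      rw [← avg_const_mul, ← avg_sub]
      exact avg_congr fun G _ => by rw [dev]; ring
    simp only [← edgeInd_eq_adjAll_mul hs' he] at h1
    rw [h2] at h1
    have h3 : 8 * (24 * ((W \ {a, b}).card : ℝ) + 1063) / ν ^ 3 ≤ 8 * (24 * m + 1063) / ν ^ 3 := by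
      have : ((W \ {a, b}).card : ℝ) ≤ m := by exact_mod_cast hcard
      gcongr
    rw [Finset.card_insert_of_notMem he]
    rw [funext (edgeInd_insert a b s)]
    generalize avg r (edgeInd s) = E at *
    generalize avg r (fun G => adjInd G a b * edgeInd s G) = E1 at *
    generalize (r / Fintype.card V : ℝ) = p at *
    have h4 := h1.trans h3
    generalize 8 * (24 * (m : ℝ) + 1063) / ν ^ 3 = K at *
    generalize s.card = n at *
    calc |E1 - p ^ (n + 1)| = |(E1 - p * E) + p * (E - p ^ n)| := by ring_nf
      _ ≤ |E1 - p * E| + p * |E - p ^ n| := by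
          refine (abs_add_le _ _).trans ?_
          rw [abs_mul, abs_of_nonneg hp0]
      _ ≤ K + 1 * (n * K) := by
          exact add_le_add h4 (mul_le_mul hp1 ih (abs_nonneg _) zero_le_one)
      _ = _ := by push_cast; ring

lemma sum_adjInd_compl [DecidableEq V] (G : SimpleGraph V) (a : V) :
    ∑ b, adjInd Gᶜ a b = Fintype.card V - 1 - ∑ b, adjInd G a b := by
  have h : ∀ b, adjInd Gᶜ a b = 1 - (if a = b then 1 else 0) - adjInd G a b := by
    intro b
    by_cases hab : a = b
    · subst hab; simp [adjInd_self]
    · by_cases h : G.Adj a b <;> simp [adjInd, h, hab]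
  simp [h, Finset.sum_sub_distrib]

lemma compl_mem_regSet {k : ℕ} (hk : r + k + 1 = Fintype.card V) {G : SimpleGraph V}
    (hG : G ∈ regSet V r) : Gᶜ ∈ regSet V k := by
  classical
  rw [mem_regSet] at hG ⊢
  intro a
  rw [sum_adjInd_compl, hG a, ← hk]
  push_cast
  ring

/-- Passing to the complement exchanges edges and non-edges. -/
lemma avg_edgeInd_eq_avg_nonedgeInd {k : ℕ} (hk : r + k + 1 = Fintype.card V)
    (s : Finset (Sym2 V)) (hs : ∀ e ∈ s, ¬ e.IsDiag) :
    avg r (edgeInd s) = avg k (nonedgeInd s) := by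
  have hk' : k + r + 1 = Fintype.card V := by omega
  have hcompl : ∀ G : SimpleGraph V, edgeInd s G = nonedgeInd s Gᶜ := by
    intro G
    have : (∀ e ∈ s, e ∈ G.edgeSet) ↔ ∀ e ∈ s, e ∉ (Gᶜ).edgeSet := by
      refine forall₂_congr fun e he => ?_
      have hd := hs e he
      induction e with | _ a b => ?_
      rw [Sym2.mk_isDiag_iff] at hd
      simp [hd]
    exact congrArg propInd (propext this)
  have hcard : (regSet V r).card = (regSet V k).card :=
    Finset.card_nbij' compl compl (fun G hG => compl_mem_regSet hk hG)
      (fun G hG => compl_mem_regSet hk' hG) (fun G _ => compl_compl G) (fun G _ => compl_compl G)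
  unfold avg
  rw [hcard]
  congr 1
  exact Finset.sum_nbij' compl compl (fun G hG => compl_mem_regSet hk hG)
    (fun G hG => compl_mem_regSet hk' hG) (fun G _ => compl_compl G) (fun G _ => compl_compl G)
    (fun G _ => hcompl G)

lemma regSet_compl_nonempty {k : ℕ} (hk : r + k + 1 = Fintype.card V)
    (hne : (regSet V r).Nonempty) : (regSet V k).Nonempty :=
  ⟨_, compl_mem_regSet hk hne.choose_spec⟩

lemma abs_pow_sub_pow_le {x y δ : ℝ} (hx : 0 ≤ x) (hx1 : x ≤ 1) (hy : 0 ≤ y) (hy1 : y ≤ 1)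
    (h : |x - y| ≤ δ) (n : ℕ) : |x ^ n - y ^ n| ≤ n * δ := by
  induction n with
  | zero => simp
  | succ n ih =>
    calc |x ^ (n + 1) - y ^ (n + 1)| = |x * (x ^ n - y ^ n) + y ^ n * (x - y)| := by ring_nf
      _ ≤ x * |x ^ n - y ^ n| + y ^ n * |x - y| := by
          refine (abs_add_le _ _).trans ?_
          rw [abs_mul, abs_mul, abs_of_nonneg hx, abs_of_nonneg (pow_nonneg hy n)]
      _ ≤ 1 * (n * δ) + 1 * δ :=
          add_le_add (mul_le_mul hx1 ih (abs_nonneg _) zero_le_one)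
            (mul_le_mul (pow_le_one₀ hy hy1) h (abs_nonneg _) zero_le_one)
      _ = _ := by push_cast; ring

/-- Pattern probabilities in random regular graphs: for a pattern with `n` edges on at most `m`
vertices, the probability is `(r / N) ^ n` up to a relative error `O(r ^ (-3/4))`, as soon as `r`
and `N - 1 - r` are large. -/
theorem abs_avg_edgeInd_sub_le (m n : ℕ) : ∃ C : ℝ, 0 ≤ C ∧ ∀ (V : Type) [Fintype V] (r k : ℕ),
    r + k + 1 = Fintype.card V → 2000 * (m + 2) ≤ r → 2000 * (m + 2) ≤ k →
    (regSet V r).Nonempty → ∀ (W : Finset V), W.card ≤ m → ∀ s : Finset (Sym2 V), s.card = n →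
    (∀ e ∈ s, e ∈ pairsIn W ∧ ¬ e.IsDiag) → ∀ ρ : ℝ, 1 ≤ ρ → ρ ^ 4 = r →
    |avg r (edgeInd s) - (r / Fintype.card V : ℝ) ^ n| ≤
      C / ρ ^ 3 * (r / Fintype.card V : ℝ) ^ n := by
  refine ⟨((48 * m + 1193) ^ n - 1) + (n * (8 * (24 * m + 1063)) + n * (48 * m + 1193)) * 4 ^ n,
    ?_, ?_⟩
  · have : (1 : ℝ) ≤ (48 * m + 1193) ^ n := one_le_pow₀ (by linarith [Nat.cast_nonneg (α := ℝ) m])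
    have h2 : (0 : ℝ) ≤ (n * (8 * (24 * m + 1063)) + n * (48 * m + 1193)) * 4 ^ n := by positivity
    linarith
  intro V _ r k hk hr hk' hne W hW s hsn hs ρ hρ hρr
  have hρ0 : 0 < ρ := by linarith
  have hN0 : (0 : ℝ) < Fintype.card V := Nat.cast_pos.2 (by omega)
  have hr0 : (0 : ℝ) < r := Nat.cast_pos.2 (by omega)
  have hrN : (r : ℝ) ≤ Fintype.card V := Nat.cast_le.2 (by omega)
  have hkN : (r : ℝ) + k + 1 = Fintype.card V := by exact_mod_cast hk
  have h34 : ρ ^ 3 ≤ ρ ^ 4 := pow_le_pow_right₀ hρ (by norm_num)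
  set p : ℝ := r / Fintype.card V with hp
  have hp0 : 0 < p := by positivity
  have hA : (0 : ℝ) ≤ (48 * m + 1193) ^ n - 1 :=
    sub_nonneg.2 (one_le_pow₀ (by linarith [Nat.cast_nonneg (α := ℝ) m]))
  have hB : (0 : ℝ) ≤ n * (8 * (24 * m + 1063)) := by positivity
  have hD : (0 : ℝ) ≤ n * (48 * m + 1193) := by positivity
  -- For `p ≥ 1/4` an absolute error is a relative one at the cost of a factor `4^n`.
  have hdense : ∀ x : ℝ, 0 ≤ x → 1 / 4 ≤ p → x ≤ x * 4 ^ n * p ^ n := by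
    intro x hx hp4
    have : 1 ≤ (4 * p) ^ n := one_le_pow₀ (by linarith)
    rw [mul_pow] at this
    nlinarith
  rcases le_or_gt (4 * r) (Fintype.card V) with h1 | h1
  · have h := abs_avg_edgeInd_sub_le_of_sparse hr h1 hne hW s hs
    rw [hsn] at h
    refine h.trans (mul_le_mul_of_nonneg_right ?_ (by positivity))
    rw [← hρr]
    gcongr
    have : 0 ≤ (n * (8 * (24 * (m : ℝ) + 1063)) + n * (48 * m + 1193)) * 4 ^ n := by positivity
    linarith
  have h1' : (Fintype.card V : ℝ) < 4 * r := by exact_mod_cast h1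
  have hp4 : 1 / 4 ≤ p := by rw [hp, le_div_iff₀ hN0]; linarith
  rcases le_or_gt (4 * k) (Fintype.card V) with h2 | h2
  · have h := abs_avg_nonedgeInd_sub_le_of_sparse hk' h2 (regSet_compl_nonempty hk hne) hW s hs
    rw [← avg_edgeInd_eq_avg_nonedgeInd hk s fun e he => (hs e he).2, hsn] at h
    have hq : 0 ≤ 1 - (k : ℝ) / Fintype.card V ∧ 1 - (k : ℝ) / Fintype.card V ≤ 1 := by
      have := density_mem (V := V) (r := k) (by omega)
      constructor <;> linarith [this.1, this.2]
    -- The complement has degree `N - 1 - r`, so its non-edge density exceeds `p` by exactly `1 /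
    -- N`.
    have hpq : |1 - (k : ℝ) / Fintype.card V - p| ≤ 1 / Fintype.card V := by
      have : 1 - (k : ℝ) / Fintype.card V - p = 1 / Fintype.card V := by
        rw [hp]
        field_simp
        linarith
      rw [this, abs_of_pos (by positivity)]
    have h3 := abs_pow_sub_pow_le hq.1 hq.2 hp0.le (density_mem (by omega)).2 hpq n
    have h4 : |avg r (edgeInd s) - p ^ n| ≤ n * (48 * m + 1193) / Fintype.card V := by
      refine (abs_sub_le _ _ _).trans ((add_le_add h h3).trans (le_of_eq ?_))
      ring
    have h5 : n * (48 * (m : ℝ) + 1193) / Fintype.card V ≤ n * (48 * m + 1193) / ρ ^ 3 := by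
      apply div_le_div_of_nonneg_left hD (by positivity)
      linarith
    refine h4.trans (h5.trans ((hdense _ (by positivity) hp4).trans ?_))
    refine mul_le_mul_of_nonneg_right ?_ (by positivity)
    rw [div_mul_eq_mul_div]
    refine div_le_div_of_nonneg_right ?_ (by positivity)
    have : (0 : ℝ) ≤ n * (8 * (24 * m + 1063)) * 4 ^ n := by positivity
    linarith
  · have h2' : (Fintype.card V : ℝ) < 4 * k := by exact_mod_cast h2
    -- Neither `r` nor `k` is at most `N / 4`, so `p` lies in `[1/4, 3/4]`.
    have hσ : (1 : ℝ) / 8 ≤ p * (1 - p) := by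
      have : p ≤ 3 / 4 := by rw [hp, div_le_iff₀ hN0]; linarith
      nlinarith
    set ν : ℝ := (Fintype.card V : ℝ) ^ (1 / 4 : ℝ) with hν
    have hνV : ν ^ 4 = Fintype.card V := by
      rw [hν, ← Real.rpow_natCast, ← Real.rpow_mul hN0.le]
      norm_num
    have hνρ : ρ ≤ ν := by
      refine (pow_le_pow_iff_left₀ hρ0.le (by positivity) (by norm_num : 4 ≠ 0)).1 ?_
      rw [hρr, hνV]
      exact hrN
    have h := abs_avg_edgeInd_sub_le_of_dense (hρ.trans hνρ) hνV (by omega) (by omega) hσ hne hW s hs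
    rw [hsn] at h
    have h5 : n * (8 * (24 * (m : ℝ) + 1063) / ν ^ 3) ≤ n * (8 * (24 * m + 1063)) / ρ ^ 3 := by
      rw [← mul_div_assoc]
      exact div_le_div_of_nonneg_left hB (by positivity) (pow_le_pow_left₀ hρ0.le hνρ 3)
    refine h.trans (h5.trans ((hdense _ (by positivity) hp4).trans ?_))
    refine mul_le_mul_of_nonneg_right ?_ (by positivity)
    rw [div_mul_eq_mul_div]
    refine div_le_div_of_nonneg_right ?_ (by positivity)
    have : (0 : ℝ) ≤ n * (48 * m + 1193) * 4 ^ n := by positivity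
    linarith

end Patterns

/-! ### Existence of regular graphs by circulants -/

section Existence

/-- A symmetric set of residues avoiding `0`, used as the jumps of a circulant graph. -/
def IsJump (N r : ℕ) (x : ℕ) : Prop :=
  x ≠ 0 ∧ (x ≤ r / 2 ∨ N - x ≤ r / 2 ∨ (r % 2 = 1 ∧ 2 * x = N))

-- For odd `r` the parity condition makes `N` even, and the self-inverse jump `N / 2` supplies the
-- single missing neighbour.
open Classical in
lemma card_isJump {N r : ℕ} (hr : r < N) (he : Even (r * N)) :
    ((Finset.range N).filter (IsJump N r)).card = r := by
  have hN : r % 2 = 1 → N % 2 = 0 := by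
    intro h
    rw [Nat.even_mul, Nat.even_iff, Nat.even_iff] at he
    omega
  have h1 : (Finset.range N).filter (IsJump N r) =
      (Finset.Icc 1 (r / 2) ∪ Finset.Ico (N - r / 2) N) ∪
        (if r % 2 = 1 then {N / 2} else ∅) := by
    ext x
    by_cases h : r % 2 = 1
    · have := hN h
      simp only [h, if_true, Finset.mem_filter, Finset.mem_range, IsJump, Finset.mem_union,
        Finset.mem_Icc, Finset.mem_Ico, Finset.mem_singleton, true_and]
      omega
    · simp only [h, if_false, Finset.mem_filter, Finset.mem_range, IsJump, Finset.mem_union,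
        Finset.mem_Icc, Finset.mem_Ico, Finset.notMem_empty, false_and, or_false]
      omega
  rw [h1, Finset.card_union_of_disjoint, Finset.card_union_of_disjoint, Nat.card_Icc, Nat.card_Ico]
  · by_cases h : r % 2 = 1
    · simp only [h, if_true, Finset.card_singleton]
      omega
    · simp only [h, if_false, Finset.card_empty]
      omega
  · rw [Finset.disjoint_left]
    intro x hx
    rw [Finset.mem_Icc] at hx
    rw [Finset.mem_Ico]
    omega
  · rw [Finset.disjoint_left]
    intro x hx
    rw [Finset.mem_union, Finset.mem_Icc, Finset.mem_Ico] at hx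
    by_cases h : r % 2 = 1
    · have := hN h
      simp only [h, if_true, Finset.mem_singleton]
      omega
    · simp [h]

lemma isJump_neg {N r : ℕ} [NeZero N] (x : Fin N) (h : IsJump N r x.val) :
    IsJump N r (-x).val := by
  have hx : x ≠ 0 := by
    rintro rfl
    exact h.1 (by simp)
  have hlt := x.isLt
  rw [Fin.val_neg, if_neg hx]
  unfold IsJump at *
  omega

/-- There is an `r`-regular graph on `N` vertices as soon as `r < N` and `r N` is even. -/
theorem regSet_nonempty {N r : ℕ} (hr : r < N) (he : Even (r * N)) :
    (regSet (Fin N) r).Nonempty := by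
  classical
  have : NeZero N := ⟨by omega⟩
  let G : SimpleGraph (Fin N) :=
    { Adj := fun a b => IsJump N r (b - a).val
      symm := ⟨fun a b h => by
        have := isJump_neg _ h
        rwa [neg_sub] at this⟩
      loopless := ⟨fun a h => h.1 (by simp)⟩ }
  refine ⟨G, mem_regSet.2 fun a => ?_⟩
  have h1 : ∑ b, adjInd G a b = ∑ x : Fin N, if IsJump N r x.val then (1 : ℝ) else 0 := by
    rw [← Equiv.sum_comp (Equiv.subRight a) fun x : Fin N =>
      if IsJump N r x.val then (1 : ℝ) else 0]
    refine Finset.sum_congr rfl fun b _ => ?_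
    by_cases h : IsJump N r (b - a).val
    · rw [adjInd_of_adj (show G.Adj a b from h)]
      exact (if_pos h).symm
    · rw [adjInd_of_not_adj (show ¬ G.Adj a b from h)]
      exact (if_neg h).symm
  rw [h1, Fin.sum_univ_eq_sum_range (fun x => if IsJump N r x then (1 : ℝ) else 0) N,
    Finset.sum_boole, card_isJump hr he]

end Existence

/-! ### From probability measures to finite averages -/

section Measures

/-- A graph is determined by its edge set, so any event is the preimage of a finite, hence
measurable, family of edge sets. -/
lemma measurableSet_simpleGraph {V : Type*} [Finite V] (E : Set (SimpleGraph V)) :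
    MeasurableSet E := by
  have h : MeasurableSet (SimpleGraph.edgeSet '' E) := (Set.toFinite _).measurableSet
  have := SimpleGraph.measurable_edgeSet h
  rwa [Set.preimage_image_eq _ SimpleGraph.edgeSet_injective] at this

lemma regularGraphs_eq (N d : ℕ) : regularGraphs N d = ↑(regSet (Fin N) d) := by
  classical
  ext G
  rw [Finset.mem_coe, mem_regSet]
  refine forall_congr' fun a => ?_
  have : ∑ b, adjInd G a b = (G.degree a : ℝ) := by
    rw [← SimpleGraph.card_neighborFinset_eq_degree, SimpleGraph.neighborFinset_eq_filter]
    simp [adjInd]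
  rw [this, Nat.cast_inj]

/-- Probabilities under the uniform random regular graph are averages over regular graphs. -/
lemma uniformRegular_real (N d : ℕ) (E : Set (SimpleGraph (Fin N))) :
    (uniformRegular N d).real E = avg d (fun G => propInd (G ∈ E)) := by
  classical
  have hE : E = ↑(Set.toFinite E).toFinset := by simp
  rw [uniformRegular, regularGraphs_eq, measureReal_def]
  conv_lhs => rw [hE]
  rw [ProbabilityTheory.uniformOn_apply_finset' (measurableSet_simpleGraph _)
    (measurableSet_simpleGraph _), ENNReal.toReal_div, ENNReal.toReal_natCast,
    ENNReal.toReal_natCast, avg]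
  congr 1
  simp only [propInd]
  rw [← Finset.sum_filter, Finset.sum_const, nsmul_eq_mul, mul_one]
  congr 2
  ext G
  simp

/-- The probability that given pairs are all edges of the Erdős–Rényi graph. -/
lemma erdosRenyi_real {N : ℕ} {p : ℝ} (hp0 : 0 ≤ p) (hp1 : p ≤ 1) (s : Finset (Sym2 (Fin N)))
    (hs : ∀ e ∈ s, ¬ e.IsDiag) :
    (erdosRenyi N p).real {G | ∀ e ∈ s, e ∈ G.edgeSet} = p ^ s.card := by
  -- `fromEdgeSet` discards loops, which is harmless because `s` has none.
  have hpre : SimpleGraph.fromEdgeSet ⁻¹' {G : SimpleGraph (Fin N) | ∀ e ∈ s, e ∈ G.edgeSet} =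
      {S : Set (Sym2 (Fin N)) | ∀ e ∈ s, e ∈ S} := by
    ext S
    refine forall₂_congr fun e he => ?_
    have := hs e he
    simp [this]
  have hpi : (fun P : Sym2 (Fin N) → Prop => {i | P i}) ⁻¹'
      {S : Set (Sym2 (Fin N)) | ∀ e ∈ s, e ∈ S} = Set.pi s fun _ => {True} := by
    ext P
    simp [Set.mem_pi]
  rw [erdosRenyi, measureReal_def, SimpleGraph.binomialRandom_eq_map,
    Measure.map_apply SimpleGraph.measurable_fromEdgeSet (measurableSet_simpleGraph _), hpre,
    ProbabilityTheory.setBernoulli_apply', hpi, Measure.infinitePi_pi _ (by simp)]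
  rw [Finset.prod_congr rfl (g := fun _ => ENNReal.ofReal p), Finset.prod_const, ENNReal.toReal_pow,
    ENNReal.toReal_ofReal hp0]
  intro e he
  have hmem : p ∈ Set.Icc (0 : ℝ) 1 := ⟨hp0, hp1⟩
  have := hs e he
  simp [this, Set.projIcc_of_mem zero_le_one hmem]
  rw [ENNReal.ofReal, ENNReal.coe_inj]
  ext
  simp [hp0]

end Measures

/-! ### Fixed subgraphs and asymptotics -/

section Containing

/-- A finite graph with names in `ℕ` as a set of pairs of vertices of `Fin N`. -/
lemma exists_pattern (T : SimpleGraph ℕ) (hT : T.edgeSet.Finite) :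
    ∃ M : ℕ, ∀ N, M ≤ N → ∃ (W : Finset (Fin N)) (s : Finset (Sym2 (Fin N))), W.card ≤ M ∧
      s.card = T.edgeSet.ncard ∧ (∀ e ∈ s, e ∈ pairsIn W ∧ ¬ e.IsDiag) ∧
      containing T N = {G | ∀ e ∈ s, e ∈ G.edgeSet} := by
  classical
  -- One `M` bounds the names of non-isolated vertices, the size of `W` and the least admissible
  -- `N`.
  obtain ⟨M, hM⟩ : ∃ M : ℕ, ∀ i j, T.Adj i j → i < M := by
    have hfin : {i | ∃ j, T.Adj i j}.Finite := by
      have : {i | ∃ j, T.Adj i j} ⊆ ⋃ e ∈ T.edgeSet, {i | i ∈ e} := by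
        rintro i ⟨j, hij⟩
        simp only [Set.mem_iUnion]
        exact ⟨s(i, j), hij, by simp⟩
      refine Set.Finite.subset (hT.biUnion fun e _ => ?_) this
      induction e with | _ a b => ?_
      exact (Set.toFinite {a, b}).subset (by intro x; simp)
    obtain ⟨M, hM⟩ := hfin.bddAbove
    exact ⟨M + 1, fun i j hij => Nat.lt_succ_of_le (hM ⟨j, hij⟩)⟩
  refine ⟨M, fun N hN => ?_⟩
  have hinj : Function.Injective (Sym2.map (Fin.val : Fin N → ℕ)) :=
    Sym2.map.injective Fin.val_injective
  refine ⟨Finset.univ.filter fun v => v.val < M,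
    Finset.univ.filter fun e => e.map Fin.val ∈ T.edgeSet, ?_, ?_, ?_, ?_⟩
  · rw [← Finset.card_map Fin.valEmbedding]
    refine (Finset.card_le_card (t := Finset.range M) ?_).trans (by simp)
    intro x
    simp only [Finset.mem_map, Finset.mem_filter, Finset.mem_range]
    rintro ⟨v, hv, rfl⟩
    exact hv.2
  · rw [← Finset.card_image_of_injective _ hinj, ← Set.ncard_coe_finset]
    congr 1
    ext e
    simp only [Finset.coe_image, Set.mem_image, Finset.mem_coe, Finset.mem_filter,
      Finset.mem_univ, true_and]
    constructor
    · rintro ⟨x, hx, rfl⟩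
      exact hx
    · intro he
      induction e with | _ i j => ?_
      have hi := hM i j he
      have hj := hM j i (T.adj_symm he)
      exact ⟨s(⟨i, by omega⟩, ⟨j, by omega⟩), by simpa using he, by simp⟩
  · intro e he
    rw [Finset.mem_filter] at he
    induction e with | _ i j => ?_
    have hij : T.Adj i.val j.val := by simpa using he.2
    rw [mk_mem_pairsIn, Sym2.mk_isDiag_iff]
    refine ⟨⟨by simpa using hM _ _ hij, by simpa using hM _ _ (T.adj_symm hij)⟩, ?_⟩
    rintro rfl
    exact T.loopless.irrefl _ hij
  · ext G
    simp only [containing, Set.mem_ofPred_eq, Finset.mem_filter, Finset.mem_univ, true_and]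
    constructor
    · intro h e he
      induction e with | _ i j => ?_
      obtain ⟨hi, hj, hG⟩ := h i.val j.val (by simpa using he)
      exact hG
    · intro h i j hij
      have hi := hM i j hij
      have hj := hM j i (T.adj_symm hij)
      refine ⟨by omega, by omega, ?_⟩
      exact h s(⟨i, by omega⟩, ⟨j, by omega⟩) (by simpa using hij)

/-- Subgraph probabilities in random regular graphs, with an explicit rate. -/
theorem abs_uniformRegular_containing_sub_le (T : SimpleGraph ℕ) (hT : T.edgeSet.Finite) :
    ∃ (C : ℝ) (R : ℕ), ∀ N d : ℕ, Even (d * N) → R < d → R + d < N →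
      |(uniformRegular N d).real (containing T N) - ((d : ℝ) / N) ^ T.edgeSet.ncard| ≤
        C * (d : ℝ) ^ (-(3 / 4) : ℝ) * ((d : ℝ) / N) ^ T.edgeSet.ncard := by
  obtain ⟨M, hM⟩ := exists_pattern T hT
  obtain ⟨C, -, hC⟩ := abs_avg_edgeInd_sub_le M T.edgeSet.ncard
  refine ⟨C, 2000 * (M + 2), fun N d he hd hN => ?_⟩
  obtain ⟨W, s, hW, hs, hpairs, hcont⟩ := hM N (by omega)
  have hd0 : (0 : ℝ) < d := Nat.cast_pos.2 (by omega)
  have h := hC (Fin N) d (N - 1 - d) (by rw [Fintype.card_fin]; omega) (by omega) (by omega)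
    (regSet_nonempty (by omega) he) W hW s hs hpairs ((d : ℝ) ^ (1 / 4 : ℝ))
    (Real.one_le_rpow (Nat.one_le_cast.2 (by omega)) (by norm_num))
    (by rw [← Real.rpow_natCast, ← Real.rpow_mul hd0.le]; norm_num)
  rw [Fintype.card_fin] at h
  rw [uniformRegular_real, hcont]
  have h3 : C / ((d : ℝ) ^ (1 / 4 : ℝ)) ^ 3 = C * (d : ℝ) ^ (-(3 / 4) : ℝ) := by
    rw [← Real.rpow_natCast, ← Real.rpow_mul hd0.le, Real.rpow_neg hd0.le, div_eq_mul_inv]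
    norm_num
  rw [h3] at h
  exact h

lemma erdosRenyi_containing (T : SimpleGraph ℕ) (hT : T.edgeSet.Finite) :
    ∃ M : ℕ, ∀ N, M ≤ N → ∀ p : ℝ, 0 ≤ p → p ≤ 1 →
      (erdosRenyi N p).real (containing T N) = p ^ T.edgeSet.ncard := by
  obtain ⟨M, hM⟩ := exists_pattern T hT
  refine ⟨M, fun N hN p hp0 hp1 => ?_⟩
  obtain ⟨W, s, hW, hs, hpairs, hcont⟩ := hM N hN
  rw [hcont, erdosRenyi_real hp0 hp1 s fun e he => (hpairs e he).2, hs]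

lemma isLittleO_rpow_of_lt {a b : ℝ} (hab : a < b) :
    (fun x : ℝ => x ^ a) =o[atTop] fun x : ℝ => x ^ b := by
  refine (isLittleO_iff_tendsto' ?_).2 ?_
  · filter_upwards [eventually_gt_atTop 0] with x hx h
    exact absurd h (Real.rpow_pos_of_pos hx b).ne'
  · refine (tendsto_rpow_neg_atTop (sub_pos.2 hab)).congr' ?_
    filter_upwards [eventually_gt_atTop 0] with x hx
    rw [← Real.rpow_sub hx, neg_sub]

/-- The relative error in the subgraph probabilities of random regular graphs. -/
lemma exists_relative_error (d : ℕ → ℕ) (hd : ∀ N, 2 ≤ N → 1 ≤ d N ∧ d N < N ∧ Even (d N * N))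
    (h1 : Tendsto (fun N => (d N : ℝ)) atTop atTop)
    (h2 : Tendsto (fun N : ℕ => (N : ℝ) - (d N : ℝ)) atTop atTop)
    (T : SimpleGraph ℕ) (hT : T.edgeSet.Finite) :
    ∃ ε : ℕ → ℝ, ε =o[atTop] (fun N : ℕ => (d N : ℝ) ^ (-(1 / 2) : ℝ)) ∧
      ∀ᶠ N in atTop, (uniformRegular N (d N)).real (containing T N) =
        ((d N : ℝ) / (N : ℝ)) ^ T.edgeSet.ncard * (1 + ε N) := by
  obtain ⟨C, R, hC⟩ := abs_uniformRegular_containing_sub_le T hT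
  refine ⟨fun N => (uniformRegular N (d N)).real (containing T N) /
    ((d N : ℝ) / (N : ℝ)) ^ T.edgeSet.ncard - 1, ?_, ?_⟩
  · have hO : (fun N => (uniformRegular N (d N)).real (containing T N) /
        ((d N : ℝ) / (N : ℝ)) ^ T.edgeSet.ncard - 1) =O[atTop]
        (fun N : ℕ => (d N : ℝ) ^ (-(3 / 4) : ℝ)) := by
      refine IsBigO.of_bound C ?_
      filter_upwards [h1.eventually_gt_atTop (R : ℝ), h2.eventually_gt_atTop (R : ℝ),
        eventually_ge_atTop 2] with N hN1 hN2 hN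
      have hRd : R < d N := by exact_mod_cast hN1
      have hRN : R + d N < N := by
        have : (R : ℝ) + d N < N := by linarith
        exact_mod_cast this
      have h := hC N (d N) (hd N hN).2.2 hRd hRN
      have hd0 : (0 : ℝ) < d N := Nat.cast_pos.2 (hd N hN).1
      have hN0 : (0 : ℝ) < N := Nat.cast_pos.2 (by omega)
      have hp : 0 < ((d N : ℝ) / (N : ℝ)) ^ T.edgeSet.ncard := by positivity
      rw [Real.norm_eq_abs, Real.norm_of_nonneg (Real.rpow_nonneg hd0.le _), div_sub_one hp.ne',
        abs_div, abs_of_pos hp, div_le_iff₀ hp]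
      exact h
    -- The gap between the exponents `-3/4` and `-1/2` turns the big-O rate into the required
    -- little-o.
    have ho : (fun N : ℕ => (d N : ℝ) ^ (-(3 / 4) : ℝ)) =o[atTop]
        (fun N : ℕ => (d N : ℝ) ^ (-(1 / 2) : ℝ)) :=
      (isLittleO_rpow_of_lt (by norm_num)).comp_tendsto h1
    exact hO.trans_isLittleO ho
  · filter_upwards [eventually_ge_atTop 2] with N hN
    have hd0 : (0 : ℝ) < d N := Nat.cast_pos.2 (hd N hN).1
    have hN0 : (0 : ℝ) < N := Nat.cast_pos.2 (by omega)
    have hp : 0 < ((d N : ℝ) / (N : ℝ)) ^ T.edgeSet.ncard := by positivity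
    field_simp
    ring

end Containing

end RandomRegular

/-! ### The theorem -/

theorem proposition1p4 (d : ℕ → ℕ)
    (hd : ∀ N, 2 ≤ N → 1 ≤ d N ∧ d N < N ∧ Even (d N * N)) :
    ((∃ η : ℝ, 0 < η ∧
        Tendsto (fun N => (d N : ℝ)) atTop atTop ∧
        Tendsto (fun N : ℕ => (N : ℝ) - (d N : ℝ)) atTop atTop ∧
        Tendsto (fun N : ℕ => |(N : ℝ) / 2 - (d N : ℝ) - η * √(d N : ℝ)|) atTop atTop) →
      ∀ T : SimpleGraph ℕ, T.edgeSet.Finite →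
        ∃ ε : ℕ → ℝ, ε =o[atTop] (fun N : ℕ => (d N : ℝ) ^ (-(1 / 2) : ℝ)) ∧
          ∀ᶠ N in atTop,
            (RandomRegular.uniformRegular N (d N)).real (RandomRegular.containing T N) =
              ((d N : ℝ) / (N : ℝ)) ^ T.edgeSet.ncard * (1 + ε N)) ∧
    (∀ c : ℝ, 0 < c → c < 1 → c ≠ 1 / 2 →
      Tendsto (fun N : ℕ => (d N : ℝ) / (N : ℝ)) atTop (𝓝 c) →
        ∃ L : SimpleGraph ℕ → ℝ,
          (∀ T : SimpleGraph ℕ, T.edgeSet.Finite → L T = c ^ T.edgeSet.ncard) ∧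
          RandomRegular.HasGraphonLimit
            (fun N => RandomRegular.uniformRegular N (d N)) L ∧
          RandomRegular.HasGraphonLimit
            (fun N => RandomRegular.erdosRenyi N ((d N : ℝ) / (N : ℝ))) L) := by
  constructor
  · rintro ⟨η, -, h1, h2, -⟩ T hT
    exact RandomRegular.exists_relative_error d hd h1 h2 T hT
  · intro c hc0 hc1 _ hc
    refine ⟨fun T => c ^ T.edgeSet.ncard, fun T _ => rfl, ?_, ?_⟩
    · intro T hT
      -- Since `0 < c < 1`, both `d = (d/N) N` and `N - d = (1 - d/N) N` tend to infinity, so the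
      -- relative error estimate applies.
      have h1 : Tendsto (fun N => (d N : ℝ)) atTop atTop := by
        refine (hc.pos_mul_atTop hc0 tendsto_natCast_atTop_atTop).congr' ?_
        filter_upwards [eventually_ge_atTop 1] with N hN
        have : (N : ℝ) ≠ 0 := Nat.cast_ne_zero.2 (by omega)
        field_simp
      have h2 : Tendsto (fun N : ℕ => (N : ℝ) - (d N : ℝ)) atTop atTop := by
        refine ((hc.const_sub 1).pos_mul_atTop (by linarith) tendsto_natCast_atTop_atTop).congr' ?_
        filter_upwards [eventually_ge_atTop 1] with N hN
        have : (N : ℝ) ≠ 0 := Nat.cast_ne_zero.2 (by omega)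
        field_simp
      obtain ⟨ε, hε, h⟩ := RandomRegular.exists_relative_error d hd h1 h2 T hT
      have hε0 : Tendsto ε atTop (𝓝 0) :=
        hε.trans_tendsto ((tendsto_rpow_neg_atTop (by norm_num : (0 : ℝ) < 1 / 2)).comp h1)
      have h3 := (hc.pow T.edgeSet.ncard).mul (hε0.const_add 1)
      rw [add_zero, mul_one] at h3
      exact h3.congr' (h.mono fun N hN => hN.symm)
    · intro T hT
      obtain ⟨M, hM⟩ := RandomRegular.erdosRenyi_containing T hT
      refine (hc.pow T.edgeSet.ncard).congr' ?_
      filter_upwards [eventually_ge_atTop M, eventually_ge_atTop 2] with N hN hN2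
      refine (hM N hN _ (by positivity) ?_).symm
      exact div_le_one_of_le₀ (by exact_mod_cast (hd N hN2).2.1.le) (by positivity)
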